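/- **Conventions.** Let $T$ be a complete first-order theory with monster model $\mathbb M\models T$: for some cardinal $\kappa>|T|$ (where $|T|=|L|+\aleph_0$ for the language $L$ of $T$), $\mathbb M$ is $\kappa$-saturated and strongly $\kappa$-homogeneous. "Small" means of cardinality $<\kappa$. Tuples $a,b,c,\dots$ are small (possibly infinite) tuples from $\mathbb M$, identified with the sets they enumerate when placed in a relation on sets; models $M\models T$ are small elementary substructures of $\mathbb M$; $a\equiv_A b$ means $\mathrm{tp}(a/A)=\mathrm{tp}(b/A)$. A formula $\varphi(x;y)$ has SOP$_1$ if there are tuples $(a_\eta)_{\eta\in 2^{<\omega}}$ in a model of $T$ such that $\{\varphi(x;a_{\eta|n}):n<\omega\}$ is consistent for every $\eta\in 2^\omega$, and $\{\varphi(x;a_\nu),\varphi(x;a_{\eta^\frown 1})\}$ is inconsistent whenever $\eta\in 2^{<\omega}$ and $\nu\trianglerighteq\eta^\frown\langle 0\rangle$. $T$ is NSOP$_1$ if no formula has SOP$_1$. A global type $q\in S(\mathbb M)$ is $A$-invariant if $b\equiv_A b'$ implies $\varphi(x;b)\in q\iff\varphi(x;b')\in q$. A Morley sequence over $A$ in such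 a $q$ is a sequence $(b_i)_{i<\omega}$ with $b_i\models q|_{Ab_{<i}}$ for all $i$. The formula $\varphi(x;b)$ Kim-divides over $A$ if there are an $A$-invariant global type $q\supseteq\mathrm{tp}(b/A)$ and a Morley sequence $(b_i)_{i<\omega}$ over $A$ in $q$ such that $\{\varphi(x;b_i):i<\omega\}$ is inconsistent. A formula Kim-forks over $A$ if it implies a finite disjunction of formulas each of which Kim-divides over $A$, and a type Kim-forks over $A$ if it implies a formula which does. Write $a\perp^{K}_{A}b$ if $\mathrm{tp}(a/Ab)$ does not Kim-fork over $A$. **Theorem.** Assume there is an $\mathrm{Aut}(\mathbb M)$-invariant ternary relation $\perp$ on small subsets of $\mathbb M$ which satisfies the following properties for every model $M\models T$ and all tuples from $\mathbb M$. 1. Strong finite character: if $a\not\perp_M b$, then there is a formula $\varphi(x,b,m)\in\mathrm{tp}(a/bM)$ such that $a'\not\perp_M b$ for every $a'\models\varphi(x,b,m)$. 2. Existence over models: $a\perp_M M$. 3. Monotonicity: $aa'\perp_M bb'$ implies $a\perp_M b$. 4. Symmetry: $a\perp_M b\iff b\perp_M a$. 5. The independence theorem: if $a\perp_M b$, $a'\perp_M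 c$, $b\perp_M c$ and $a\equiv_M a'$, then there is $a''$ with $a''\equiv_{Mb}a$, $a''\equiv_{Mc}a'$ and $a''\perp_M bc$. Then $T$ is NSOP$_1$, and $\perp$ strengthens Kim-independence over models: if $M\models T$ and $a\perp_M b$, then $a\perp^{K}_M b$. If, moreover, $\perp$ satisfies 6. Witnessing: if $a\not\perp_M b$ is witnessed by $\varphi(x;b)$ (that is, $\models\varphi(a;b)$ and $a'\not\perp_M b$ for every $a'\models\varphi(x;b)$), and $(b_i)_{i<\omega}$ is a Morley sequence over $M$ in a global $M$-invariant type extending $\mathrm{tp}(b/M)$, then $\{\varphi(x;b_i):i<\omega\}$ is inconsistent, then $\perp$ equals Kim-independence over models: if $M\models T$, then $a\perp_M b$ if and only if $a\perp^{K}_M b$. -/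

import Mathlib

open FirstOrder FirstOrder.Language Cardinal

universe u v w

namespace KimCriterion

section SOP1

/-- The restriction `η | n`, as a node of `2^{<ω}`, of a branch `η ∈ 2^ω`. -/
def branchNode (η : ℕ → Bool) (n : ℕ) : List Bool :=
  List.ofFn fun i : Fin n => η i

/-- In the structure `N`, the formula `φ(x; y)` has SOP₁, witnessed by tuples `a_η` from `N`
indexed by the nodes `η ∈ 2^{<ω}`. A set of instances of `φ` is consistent if it is
finitely satisfiable in `N`. -/
def FormulaHasSOP1 {L : FirstOrder.Language.{u, v}} (N : Type w) [L.Structure N] {n m : ℕ}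
    (φ : L.Formula (Fin n ⊕ Fin m)) : Prop :=
  ∃ a : List Bool → Fin m → N,
    (∀ η : ℕ → Bool, ∀ s : Finset ℕ, ∃ x : Fin n → N,
      ∀ k ∈ s, φ.Realize (Sum.elim x (a (branchNode η k)))) ∧
    (∀ η ν : List Bool, (η ++ [false]) <+: ν →
      ¬ ∃ x : Fin n → N, φ.Realize (Sum.elim x (a ν)) ∧
        φ.Realize (Sum.elim x (a (η ++ [true]))))

/-- `T` has SOP₁: some formula has SOP₁ in some model of `T`. (By the downward
Löwenheim–Skolem theorem it does not matter in which universe the model lives, as long as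
the universe is at least that of the language.) -/
def HasSOP1 {L : FirstOrder.Language.{u, v}} (T : L.Theory) : Prop :=
  ∃ (N : T.ModelType.{u, v, max u v}) (n m : ℕ) (φ : L.Formula (Fin n ⊕ Fin m)),
    FormulaHasSOP1 N φ

/-- `T` is NSOP₁. -/
def IsNSOP1 {L : FirstOrder.Language.{u, v}} (T : L.Theory) : Prop := ¬ HasSOP1 T

end SOP1

section Monster

/-- `a ≡_A b`: the tuples `a` and `b` have the same type over `A` in the structure `𝕄`. -/
def SameType (L : FirstOrder.Language.{u, v}) {𝕄 : Type w} [L.Structure 𝕄] (A : Set 𝕄) {ι : Type*}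
    (a b : ι → 𝕄) : Prop :=
  ∀ φ : L.Formula (ι ⊕ A),
    φ.Realize (Sum.elim a ((↑) : A → 𝕄)) ↔ φ.Realize (Sum.elim b ((↑) : A → 𝕄))

/-- `𝕄` is a monster model of its theory, where "small" means "of cardinality `< κ`": `κ` is
uncountable and larger than the number of formulas, `𝕄` is `κ`-saturated (every finitely
satisfiable set of formulas over a small set, in a small tuple of variables, is realized), and
`𝕄` is strongly `κ`-homogeneous (two small tuples of the same type are conjugate under an
automorphism). -/
structure IsMonster (L : FirstOrder.Language.{u, v}) (𝕄 : Type w) [L.Structure 𝕄] (κ : Cardinal.{w}) :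
    Prop where
  aleph0_lt : ℵ₀ < κ
  card_lt : Cardinal.lift.{w} L.card < Cardinal.lift.{max u v} κ
  saturated : ∀ (ι : Type w) (A : Set 𝕄), #ι < κ → #A < κ →
    ∀ p : Set (L.Formula (ι ⊕ A)),
      (∀ s : Finset (L.Formula (ι ⊕ A)), (s : Set (L.Formula (ι ⊕ A))) ⊆ p →
        ∃ a : ι → 𝕄, ∀ φ ∈ s, φ.Realize (Sum.elim a ((↑) : A → 𝕄))) →
      ∃ a : ι → 𝕄, ∀ φ ∈ p, φ.Realize (Sum.elim a ((↑) : A → 𝕄))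
  homogeneous : ∀ (ι : Type w), #ι < κ → ∀ a b : ι → 𝕄, SameType L (∅ : Set 𝕄) a b →
    ∃ σ : 𝕄 ≃[L] 𝕄, ∀ i, σ (a i) = b i

end Monster

section Kim

variable {L : FirstOrder.Language.{u, v}} {𝕄 : Type w} [L.Structure 𝕄]

/-- The formula `φ(x; b)` with parameters from `𝕄`, obtained from the `L`-formula `φ(x; y)` by
substituting (the constants naming) the tuple `b` for `y`. -/
def inst {ι β : Type*} (φ : L.Formula (ι ⊕ β)) (b : β → 𝕄) : L[[𝕄]].Formula ι :=
  BoundedFormula.constantsVarsEquiv.symm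
    (Formula.relabel (Sum.elim Sum.inr (fun i => Sum.inl (b i))) φ)

theorem realize_inst {ι β : Type*} (φ : L.Formula (ι ⊕ β)) (b : β → 𝕄) (a : ι → 𝕄) :
    (inst φ b).Realize a ↔ φ.Realize (Sum.elim a b) := by
  unfold inst
  rw [Formula.Realize, ← BoundedFormula.realize_constantsVarsEquiv, Equiv.apply_symm_apply]
  refine (Formula.realize_relabel (φ := φ)).trans ?_
  refine iff_of_eq (congrArg _ ?_)
  funext i
  rcases i with i | i <;> rfl

/-- `S_ι(𝕄)`: the global (complete) types in a tuple of variables indexed by `ι`. -/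
abbrev GlobalType (L : FirstOrder.Language.{u, v}) (𝕄 : Type w) [L.Structure 𝕄] (ι : Type*) :=
  (L.elementaryDiagram 𝕄).CompleteType ι

/-- `φ(x; b) ∈ q`. -/
def GlobalType.Has {ι β : Type*} (q : GlobalType L 𝕄 ι) (φ : L.Formula (ι ⊕ β))
    (b : β → 𝕄) : Prop :=
  Formula.equivSentence (inst φ b) ∈ q

/-- The global type `q` is `A`-invariant. -/
def GlobalType.IsInvariant {ι : Type*} (q : GlobalType L 𝕄 ι) (A : Set 𝕄) : Prop :=
  ∀ (m : ℕ) (φ : L.Formula (ι ⊕ Fin m)) (b b' : Fin m → 𝕄),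
    SameType L A b b' → (q.Has φ b ↔ q.Has φ b')

/-- `a ⊨ q|_A`. As `tp(a/A)` and `q|_A` are complete, this also says that `q ⊇ tp(a/A)`. -/
def GlobalType.RealizedOver {ι : Type*} (q : GlobalType L 𝕄 ι) (A : Set 𝕄) (a : ι → 𝕄) : Prop :=
  ∀ φ : L.Formula (ι ⊕ A),
    q.Has φ ((↑) : A → 𝕄) ↔ φ.Realize (Sum.elim a ((↑) : A → 𝕄))

/-- `(b_i)_{i < ω}` is a Morley sequence over `A` in `q`: `b_i ⊨ q|_{A b_{<i}}` for all `i`. -/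
def IsMorleySequence {ι : Type*} (q : GlobalType L 𝕄 ι) (A : Set 𝕄) (b : ℕ → ι → 𝕄) : Prop :=
  ∀ i : ℕ, q.RealizedOver (A ∪ ⋃ j < i, Set.range (b j)) (b i)

/-- The set of formulas `{φ(x; b_i) : i < ω}` is consistent (finitely satisfiable in `𝕄`). -/
def InstancesConsistent {ξ ι : Type*} (φ : L.Formula (ξ ⊕ ι)) (b : ℕ → ι → 𝕄) : Prop :=
  ∀ s : Finset ℕ, ∃ x : ξ → 𝕄, ∀ i ∈ s, φ.Realize (Sum.elim x (b i))

/-- The formula `φ(x; y)` `q`-divides over `A`. -/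
def QDivides {ξ ι : Type*} (q : GlobalType L 𝕄 ι) (A : Set 𝕄) (φ : L.Formula (ξ ⊕ ι)) : Prop :=
  ∃ b : ℕ → ι → 𝕄, IsMorleySequence q A b ∧ ¬ InstancesConsistent φ b

/-- The formula `φ(x; b)` Kim-divides over `A`. -/
def KimDivides {ξ : Type*} (A : Set 𝕄) {m : ℕ} (φ : L.Formula (ξ ⊕ Fin m))
    (b : Fin m → 𝕄) : Prop :=
  ∃ q : GlobalType L 𝕄 (Fin m), q.IsInvariant A ∧ q.RealizedOver A b ∧ QDivides q A φ

/-- The formula `φ(x; b)` Kim-forks over `A`: it implies a finite (possibly empty) disjunction of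
formulas `ψ_i(x; cⁱ)` which Kim-divide over `A`. -/
def KimForks {ξ : Type*} (A : Set 𝕄) {m : ℕ} (φ : L.Formula (ξ ⊕ Fin m))
    (b : Fin m → 𝕄) : Prop :=
  ∃ (k : ℕ) (l : Fin k → ℕ) (ψ : (i : Fin k) → L.Formula (ξ ⊕ Fin (l i)))
    (c : (i : Fin k) → Fin (l i) → 𝕄),
    (∀ x : ξ → 𝕄, φ.Realize (Sum.elim x b) → ∃ i, (ψ i).Realize (Sum.elim x (c i))) ∧
    ∀ i, KimDivides A (ψ i) (c i)

/-- The type `tp(a/B)` Kim-forks over `A`: it implies a formula `φ(x; c)` which Kim-forks over `A`.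
As `tp(a/B)` is closed under conjunctions, it implies `φ(x; c)` if and only if one of its members
`θ(x)` does. -/
def TypeKimForks (L : FirstOrder.Language.{u, v}) {𝕄 : Type w} [L.Structure 𝕄] {ξ : Type*} (A B : Set 𝕄)
    (a : ξ → 𝕄) : Prop :=
  ∃ (m : ℕ) (φ : L.Formula (ξ ⊕ Fin m)) (c : Fin m → 𝕄),
    (∃ θ : L.Formula (ξ ⊕ B), θ.Realize (Sum.elim a ((↑) : B → 𝕄)) ∧
      ∀ x : ξ → 𝕄, θ.Realize (Sum.elim x ((↑) : B → 𝕄)) → φ.Realize (Sum.elim x c)) ∧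
    KimForks A φ c

/-- Kim-independence `a ⫝ᴷ_A b`: the type `tp(a/Ab)` does not Kim-fork over `A`. -/
def KimIndep (L : FirstOrder.Language.{u, v}) {𝕄 : Type w} [L.Structure 𝕄] {ξ ι : Type*} (A : Set 𝕄)
    (a : ξ → 𝕄) (b : ι → 𝕄) : Prop :=
  ¬ TypeKimForks L A (A ∪ Set.range b) a

end Kim

section Axioms

/-! The properties of a ternary relation `Ind A C B` ("`A` is independent from `B` over `C`") on
small subsets of the monster model `𝕄`. It is applied to tuples through the sets that they
enumerate, so the concatenation of two tuples becomes a union. Models `M ⊨ T` are small elementary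
substructures of `𝕄`, and tuples are indexed by small types. -/

variable (L : FirstOrder.Language.{u, v}) {𝕄 : Type w} [L.Structure 𝕄] (κ : Cardinal.{w})
  (Ind : Set 𝕄 → Set 𝕄 → Set 𝕄 → Prop)

/-- Invariance under `Aut(𝕄)`. -/
def Invariance : Prop :=
  ∀ (σ : 𝕄 ≃[L] 𝕄) (A C B : Set 𝕄), #A < κ → #C < κ → #B < κ →
    (Ind A C B ↔ Ind (σ '' A) (σ '' C) (σ '' B))

/-- Strong finite character. -/
def StrongFiniteCharacter : Prop :=
  ∀ M : L.ElementarySubstructure 𝕄, #M < κ →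
    ∀ (ξ ι : Type w), #ξ < κ → #ι < κ → ∀ (a : ξ → 𝕄) (b : ι → 𝕄),
      ¬ Ind (Set.range a) M (Set.range b) →
      ∃ φ : L.Formula (ξ ⊕ (ι ⊕ M)),
        φ.Realize (Sum.elim a (Sum.elim b ((↑) : M → 𝕄))) ∧
        ∀ a' : ξ → 𝕄, φ.Realize (Sum.elim a' (Sum.elim b ((↑) : M → 𝕄))) →
          ¬ Ind (Set.range a') M (Set.range b)

/-- Existence over models. -/
def ExistenceOverModels : Prop :=
  ∀ M : L.ElementarySubstructure 𝕄, #M < κ →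
    ∀ (ξ : Type w), #ξ < κ → ∀ a : ξ → 𝕄, Ind (Set.range a) M M

/-- Monotonicity. -/
def Monotonicity : Prop :=
  ∀ M : L.ElementarySubstructure 𝕄, #M < κ →
    ∀ (ξ ξ' ι ι' : Type w), #ξ < κ → #ξ' < κ → #ι < κ → #ι' < κ →
    ∀ (a : ξ → 𝕄) (a' : ξ' → 𝕄) (b : ι → 𝕄) (b' : ι' → 𝕄),
      Ind (Set.range a ∪ Set.range a') M (Set.range b ∪ Set.range b') →
      Ind (Set.range a) M (Set.range b)

/-- Symmetry. -/
def Symmetry : Prop :=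
  ∀ M : L.ElementarySubstructure 𝕄, #M < κ →
    ∀ (ξ ι : Type w), #ξ < κ → #ι < κ → ∀ (a : ξ → 𝕄) (b : ι → 𝕄),
      Ind (Set.range a) M (Set.range b) ↔ Ind (Set.range b) M (Set.range a)

/-- The independence theorem over models. -/
def IndependenceTheorem : Prop :=
  ∀ M : L.ElementarySubstructure 𝕄, #M < κ →
    ∀ (ξ ι ι' : Type w), #ξ < κ → #ι < κ → #ι' < κ →
    ∀ (a a' : ξ → 𝕄) (b : ι → 𝕄) (c : ι' → 𝕄),
      Ind (Set.range a) M (Set.range b) → Ind (Set.range a') M (Set.range c) →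
      Ind (Set.range b) M (Set.range c) → SameType L (M : Set 𝕄) a a' →
      ∃ a'' : ξ → 𝕄, SameType L ((M : Set 𝕄) ∪ Set.range b) a'' a ∧
        SameType L ((M : Set 𝕄) ∪ Set.range c) a'' a' ∧
        Ind (Set.range a'') M (Set.range b ∪ Set.range c)

/-- Witnessing. That `φ(x; b)` witnesses the dependence of `a` and `b` over `M` means, as in strong
finite character, that `a` satisfies `φ(x; b)` and that everything that satisfies `φ(x; b)` depends
on `b` over `M`. (Parameters from `M` are allowed: they can be made part of the tuple `b`.) -/
def Witnessing : Prop :=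
  ∀ M : L.ElementarySubstructure 𝕄, #M < κ →
    ∀ (ξ ι : Type w), #ξ < κ → #ι < κ → ∀ (a : ξ → 𝕄) (b : ι → 𝕄) (φ : L.Formula (ξ ⊕ ι)),
      ¬ Ind (Set.range a) M (Set.range b) →
      φ.Realize (Sum.elim a b) →
      (∀ a' : ξ → 𝕄, φ.Realize (Sum.elim a' b) → ¬ Ind (Set.range a') M (Set.range b)) →
      ∀ q : GlobalType L 𝕄 ι, q.IsInvariant M → q.RealizedOver M b →
      ∀ b' : ℕ → ι → 𝕄, IsMorleySequence q M b' → ¬ InstancesConsistent φ b'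

end Axioms

end KimCriterion

/-! Everything rests on one source of independence. A tuple realizing over `M ∪ B` an ultrafilter
average of tuples from `M` is independent from `B` over `M`: by strong finite character a dependence
would already hold for some tuple from `M`, against existence and symmetry
(`IsIndependence.of_realizesAverage`). The independence theorem then amalgamates over such tuples.

NSOP₁. An SOP₁ tree yields sequences `d₀`, `d₁` in a model `M` with the same average over `M`, such
that φ is consistent along `d₀` while φ(x; d₁ i) contradicts φ(x; d₀ j) for i < j. Realizations
`g₀`, `g₁` of the averages can be taken independent from each other, and a solution `a` of all φ(x;
d₀ i) independent from `g₀`. The independence theorem gives a common solution of φ(x; g₀) and φ(x;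
g₁), and finite satisfiability in `M` turns it into a forbidden pair
(`IsIndependence.false_of_averages`, `IsIndependence.not_isSOP1Tree`).

Kim's lemma (`IsIndependence.instancesConsistent_of_morley`). If invariant types q and r agree over
`M` but ψ is consistent only along Morley sequences in q, then a Morley sequence mixing q and r,
together with automorphisms moving a q-member to an r-member, gives SOP₁ trees of every finite
height for a conjunction of instances of ψ. Compactness contradicts the previous paragraph.

Kim-independence. Let a be independent from b, and let tp(a/Mb) imply a disjunction of Kim-dividing
formulas. Along a coheir sequence of conjugates of b and of the parameters of the disjuncts,
iterating the independence theorem gives one a' suitable for all conjugates. By pigeonhole one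
disjunct holds along an infinite subsequence, and Kim's lemma contradicts its Kim-dividing.
Conversely, witnessing makes the formula from strong finite character Kim-divide along a coheir
sequence. -/

namespace KimCriterion

/-! ### Quantifying out possibly infinite tuples of variables. -/

section Formulas

variable {L : FirstOrder.Language.{u, v}}

open Classical in
/-- The finitely many variables of `φ(x; y)` among the variables `x`. -/
noncomputable def leftVars {ξ β : Type*} (φ : L.Formula (ξ ⊕ β)) : Finset ξ :=
  (BoundedFormula.freeVarFinset φ).toLeft

open Classical in
/-- The formula `φ(x; y)`, in which the tuple `x` is cut down to the variables that occur. -/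
noncomputable def restrictLeft {ξ β : Type*} (φ : L.Formula (ξ ⊕ β)) :
    L.Formula (leftVars φ ⊕ β) :=
  BoundedFormula.restrictFreeVar φ fun z =>
    match z with
    | ⟨Sum.inl x, h⟩ => Sum.inl ⟨x, by simpa [leftVars] using h⟩
    | ⟨Sum.inr y, _⟩ => Sum.inr y

theorem realize_restrictLeft {N : Type*} [L.Structure N] {ξ β : Type*} (φ : L.Formula (ξ ⊕ β))
    (a : ξ → N) (b : β → N) :
    (restrictLeft φ).Realize (Sum.elim (fun x => a x) b) ↔ φ.Realize (Sum.elim a b) := by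
  classical
  refine BoundedFormula.realize_restrictFreeVar _ ?_
  rintro ⟨x | y, h⟩ <;> rfl

theorem exists_realize_restrictLeft {N : Type*} [L.Structure N] [Nonempty N] {ξ β : Type*}
    (φ : L.Formula (ξ ⊕ β)) (x : leftVars φ → N) :
    ∃ a : ξ → N, ∀ z, a z.1 = x z := by
  classical
  exact ⟨fun z => if h : z ∈ leftVars φ then x ⟨z, h⟩ else Classical.arbitrary N, fun z => by simp⟩

/-- The formula `∃ x, φ(x; y)`. -/
noncomputable def exLeft {ξ β : Type*} (φ : L.Formula (ξ ⊕ β)) : L.Formula β :=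
  ((restrictLeft φ).relabel Sum.swap).iExs (leftVars φ)

theorem realize_exLeft {N : Type*} [L.Structure N] [Nonempty N] {ξ β : Type*}
    (φ : L.Formula (ξ ⊕ β)) (b : β → N) :
    (exLeft φ).Realize b ↔ ∃ a : ξ → N, φ.Realize (Sum.elim a b) := by
  unfold exLeft
  rw [Formula.realize_iExs]
  constructor
  · rintro ⟨x, hx⟩
    obtain ⟨a, ha⟩ := exists_realize_restrictLeft φ x
    refine ⟨a, ?_⟩
    rw [← realize_restrictLeft]
    rw [Formula.realize_relabel] at hx
    convert hx using 1
    funext z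
    rcases z with z | z <;> simp [ha]
  · rintro ⟨a, ha⟩
    refine ⟨fun x => a x, ?_⟩
    rw [Formula.realize_relabel]
    rw [← realize_restrictLeft] at ha
    convert ha using 1
    funext z
    rcases z with z | z <;> simp

/-- Only finitely many of the variables `ξ` occur in the formula, so its solvability is first-order
even when `ξ` is infinite. -/
theorem exists_realize_of_elementaryEmbedding {N N' : Type*} [L.Structure N] [L.Structure N']
    [Nonempty N] (f : N ↪ₑ[L] N') {ξ β : Type*} (φ : L.Formula (ξ ⊕ β)) (b : β → N) (a : ξ → N')
    (h : φ.Realize (Sum.elim a (f ∘ b))) : ∃ a : ξ → N, φ.Realize (Sum.elim a b) := by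
  have : Nonempty N' := ‹Nonempty N›.map f
  rw [← realize_exLeft, ← f.map_formula, realize_exLeft]
  exact ⟨a, h⟩

/-- The conjunction of the formulas `φ(x; y_i)` for `i` in `s`. -/
noncomputable def conjOver {ξ β ι : Type*} (φ : L.Formula (ξ ⊕ β)) (s : Finset ι) :
    L.Formula (ξ ⊕ (ι × β)) :=
  Formula.iInf fun i : s => φ.relabel (Sum.map id fun y => (i.1, y))

theorem realize_conjOver {N : Type*} [L.Structure N] {ξ β ι : Type*} (φ : L.Formula (ξ ⊕ β))
    (s : Finset ι) (a : ξ → N) (b : ι → β → N) :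
    (conjOver φ s).Realize (Sum.elim a fun z => b z.1 z.2) ↔
      ∀ i ∈ s, φ.Realize (Sum.elim a (b i)) := by
  unfold conjOver
  rw [Formula.realize_iInf, Subtype.forall]
  refine forall₂_congr fun i _ => ?_
  rw [Formula.realize_relabel]
  refine iff_of_eq (congrArg _ ?_)
  funext z
  rcases z with z | z <;> rfl

/-- The formula saying that the formulas `φ(x; y_i)` for `i` in `s` are jointly consistent. -/
noncomputable def consOver {ξ β ι : Type*} (φ : L.Formula (ξ ⊕ β)) (s : Finset ι) :
    L.Formula (ι × β) :=
  exLeft (conjOver φ s)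

theorem realize_consOver {N : Type*} [L.Structure N] [Nonempty N] {ξ β ι : Type*}
    (φ : L.Formula (ξ ⊕ β)) (s : Finset ι) (b : ι → β → N) :
    (consOver φ s).Realize (fun z => b z.1 z.2) ↔
      ∃ a : ξ → N, ∀ i ∈ s, φ.Realize (Sum.elim a (b i)) := by
  unfold consOver
  rw [realize_exLeft]
  simp only [realize_conjOver]

end Formulas

/-! ### Smallness of index types, in any universe. -/

section SmallTypes

/-- The type `γ` has fewer than `κ` elements. -/
def IsSmall (κ : Cardinal.{w}) (γ : Type*) : Prop :=
  ∃ γ' : Type w, #γ' < κ ∧ Nonempty (γ ≃ γ')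

variable {κ : Cardinal.{w}}

theorem IsSmall.of_lt {γ : Type w} (h : #γ < κ) : IsSmall κ γ := ⟨γ, h, ⟨Equiv.refl γ⟩⟩

theorem IsSmall.lt {γ : Type w} (h : IsSmall κ γ) : #γ < κ := by
  obtain ⟨γ', h', ⟨e⟩⟩ := h
  rwa [Cardinal.mk_congr e]

theorem IsSmall.of_injective {γ : Type*} {δ : Type*} (h : IsSmall κ δ) (f : γ → δ)
    (hf : Function.Injective f) : IsSmall κ γ := by
  obtain ⟨δ', h', ⟨e⟩⟩ := h
  exact ⟨Set.range (e ∘ f), (Cardinal.mk_set_le _).trans_lt h',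
    ⟨Equiv.ofInjective _ (e.injective.comp hf)⟩⟩

theorem IsSmall.of_surjective {γ : Type*} {δ : Type*} (h : IsSmall κ γ) (f : γ → δ)
    (hf : Function.Surjective f) : IsSmall κ δ :=
  h.of_injective _ (Function.injective_surjInv hf)

theorem IsSmall.range {γ : Type*} {δ : Type*} (h : IsSmall κ γ) (f : γ → δ) :
    IsSmall κ (Set.range f) :=
  h.of_surjective _ Set.rangeFactorization_surjective

theorem IsSmall.of_countable (hκ : ℵ₀ < κ) (γ : Type*) [Countable γ] : IsSmall κ γ := by
  obtain ⟨f, hf⟩ := exists_injective_nat γ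
  refine IsSmall.of_injective ⟨ULift.{w} ℕ, ?_, ⟨Equiv.ulift.symm⟩⟩ f hf
  simpa using hκ

theorem IsSmall.sum (hκ : ℵ₀ < κ) {γ : Type*} {δ : Type*} (h : IsSmall κ γ) (h' : IsSmall κ δ) :
    IsSmall κ (γ ⊕ δ) := by
  obtain ⟨γ', hγ, ⟨e⟩⟩ := h
  obtain ⟨δ', hδ, ⟨e'⟩⟩ := h'
  exact ⟨γ' ⊕ δ', by simpa using Cardinal.add_lt_of_lt hκ.le hγ hδ, ⟨e.sumCongr e'⟩⟩

theorem IsSmall.union (hκ : ℵ₀ < κ) {N : Type*} {A B : Set N} (h : IsSmall κ A)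
    (h' : IsSmall κ B) : IsSmall κ ↥(A ∪ B) := by
  refine (h.sum hκ h').of_surjective
    (Sum.elim (Set.inclusion Set.subset_union_left) (Set.inclusion Set.subset_union_right)) ?_
  rintro ⟨x, hx | hx⟩
  · exact ⟨Sum.inl ⟨x, hx⟩, rfl⟩
  · exact ⟨Sum.inr ⟨x, hx⟩, rfl⟩

theorem IsSmall.mono {N : Type*} {A B : Set N} (h : IsSmall κ B) (hAB : A ⊆ B) : IsSmall κ A :=
  h.of_injective _ (Set.inclusion_injective hAB)

theorem IsSmall.biUnion_lt (hκ : ℵ₀ < κ) {N : Type*} (A : ℕ → Set N) (n : ℕ)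
    (h : ∀ i < n, IsSmall κ (A i)) : IsSmall κ ↥(⋃ i < n, A i) := by
  induction n with
  | zero => simpa using IsSmall.of_countable hκ _
  | succ n ih =>
    rw [Set.biUnion_lt_succ]
    exact (ih fun i hi => h i (hi.trans n.lt_succ_self)).union hκ (h n n.lt_succ_self)

end SmallTypes

/-! ### Equality of types over a set. -/

section SameType

variable {L : FirstOrder.Language.{u, v}} {𝕄 : Type w} [L.Structure 𝕄]

theorem SameType.refl (A : Set 𝕄) {ι : Type*} (a : ι → 𝕄) : SameType L A a a := fun _ => Iff.rfl

theorem SameType.trans {A : Set 𝕄} {ι : Type*} {a b c : ι → 𝕄} (h : SameType L A a b)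
    (h' : SameType L A b c) : SameType L A a c := fun φ => (h φ).trans (h' φ)

theorem realize_map_coe {A : Set 𝕄} {ι δ : Type*} (φ : L.Formula (ι ⊕ δ)) {p : δ → 𝕄}
    (hp : ∀ z, p z ∈ A) (a : ι → 𝕄) :
    (φ.relabel (Sum.map id fun z => (⟨p z, hp z⟩ : A))).Realize (Sum.elim a ((↑) : A → 𝕄)) ↔
      φ.Realize (Sum.elim a p) := by
  rw [Formula.realize_relabel]
  refine iff_of_eq (congrArg _ ?_)
  funext z
  rcases z with z | z <;> rfl

theorem SameType.realize_iff {A : Set 𝕄} {ι δ : Type*} {a b : ι → 𝕄} (h : SameType L A a b)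
    (φ : L.Formula (ι ⊕ δ)) {p : δ → 𝕄} (hp : ∀ z, p z ∈ A) :
    φ.Realize (Sum.elim a p) ↔ φ.Realize (Sum.elim b p) := by
  rw [← realize_map_coe φ hp, ← realize_map_coe φ hp]
  exact h _

theorem SameType.comp {A : Set 𝕄} {ι ι' : Type*} {a b : ι → 𝕄} (h : SameType L A a b)
    (f : ι' → ι) : SameType L A (a ∘ f) (b ∘ f) := by
  intro φ
  have := h (φ.relabel (Sum.map f id))
  simpa only [Formula.realize_relabel, Sum.elim_comp_map, Function.comp_id] using this

theorem SameType.mono {A B : Set 𝕄} {ι : Type*} {a b : ι → 𝕄} (h : SameType L B a b)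
    (hAB : A ⊆ B) : SameType L A a b :=
  fun φ => h.realize_iff φ fun z => hAB z.2

/-- Parameters become part of the tuple; this is the form in which homogeneity applies over a small
set. -/
theorem SameType.empty_sum {A : Set 𝕄} {ι δ : Type*} {a b : ι → 𝕄} (h : SameType L A a b)
    {p : δ → 𝕄} (hp : ∀ z, p z ∈ A) :
    SameType L (∅ : Set 𝕄) (Sum.elim a p) (Sum.elim b p) := by
  intro φ
  have := h.realize_iff (φ.relabel (Sum.elim id fun z => (z.2.elim : ι ⊕ δ))) hp
  have key : ∀ c : ι → 𝕄, (Sum.elim c p ∘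
      (Sum.elim id fun z => (z.2.elim : ι ⊕ δ) : (ι ⊕ δ) ⊕ (∅ : Set 𝕄) → ι ⊕ δ)) =
      Sum.elim (Sum.elim c p) ((↑) : (∅ : Set 𝕄) → 𝕄) := by
    intro c
    funext z
    rcases z with z | z
    · rfl
    · exact z.2.elim
  simpa only [Formula.realize_relabel, key] using this

theorem sameType_of_equiv (σ : 𝕄 ≃[L] 𝕄) {A : Set 𝕄} (hσ : ∀ x ∈ A, σ x = x) {ι : Type*}
    (a : ι → 𝕄) : SameType L A a (σ ∘ a) := by
  intro φ
  rw [← StrongHomClass.realize_formula σ]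
  refine iff_of_eq (congrArg _ ?_)
  funext z
  rcases z with z | z
  · rfl
  · exact hσ z z.2

end SameType

/-! ### Saturation, homogeneity and ultrafilter averages. -/

section MonsterModel

variable {L : FirstOrder.Language.{u, v}} {𝕄 : Type w} [L.Structure 𝕄] {κ : Cardinal.{w}}

theorem IsMonster.exists_realize (h𝕄 : IsMonster L 𝕄 κ) {γ : Type*} (hγ : IsSmall κ γ) {A : Set 𝕄}
    (hA : IsSmall κ A) (p : Set (L.Formula (γ ⊕ A)))
    (hp : ∀ s : Finset (L.Formula (γ ⊕ A)), (s : Set (L.Formula (γ ⊕ A))) ⊆ p →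
      ∃ a : γ → 𝕄, ∀ φ ∈ s, φ.Realize (Sum.elim a ((↑) : A → 𝕄))) :
    ∃ a : γ → 𝕄, ∀ φ ∈ p, φ.Realize (Sum.elim a ((↑) : A → 𝕄)) := by
  classical
  obtain ⟨γ', hγ', ⟨e⟩⟩ := hγ
  have key : ∀ (φ : L.Formula (γ ⊕ A)) (a : γ' → 𝕄),
      (φ.relabel (Sum.map e id)).Realize (Sum.elim a ((↑) : A → 𝕄)) ↔
        φ.Realize (Sum.elim (a ∘ e) ((↑) : A → 𝕄)) := by
    intro φ a
    rw [Formula.realize_relabel, Sum.elim_comp_map, Function.comp_id]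
  obtain ⟨a, ha⟩ := h𝕄.saturated γ' A hγ' hA.lt ((fun φ => φ.relabel (Sum.map e id)) '' p) (by
    intro s hs
    obtain ⟨s', hs', rfl⟩ := Finset.subset_set_image_iff.1 hs
    obtain ⟨a, ha⟩ := hp s' hs'
    refine ⟨a ∘ e.symm, fun φ hφ => ?_⟩
    obtain ⟨φ', hφ', rfl⟩ := Finset.mem_image.1 hφ
    rw [key]
    simpa [Function.comp_assoc] using ha φ' hφ')
  exact ⟨a ∘ e, fun φ hφ => (key φ a).1 (ha _ ⟨φ, hφ, rfl⟩)⟩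

theorem IsMonster.exists_equiv (h𝕄 : IsMonster L 𝕄 κ) {γ : Type*} (hγ : IsSmall κ γ) {A : Set 𝕄}
    (hA : IsSmall κ A) {a b : γ → 𝕄} (h : SameType L A a b) :
    ∃ σ : 𝕄 ≃[L] 𝕄, (∀ x ∈ A, σ x = x) ∧ ∀ i, σ (a i) = b i := by
  obtain ⟨γ', hγ', ⟨e⟩⟩ := hγ.sum h𝕄.aleph0_lt hA
  have h' := (h.empty_sum (p := ((↑) : A → 𝕄)) fun z => z.2).comp e.symm
  obtain ⟨σ, hσ⟩ := h𝕄.homogeneous γ' hγ' _ _ h'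
  refine ⟨σ, fun x hx => ?_, fun i => ?_⟩
  · simpa using hσ (e (Sum.inr ⟨x, hx⟩))
  · simpa using hσ (e (Sum.inl i))

/-- The tuple `g` realizes over `A` the average along the ultrafilter `U` of the tuples `t i`. -/
def RealizesAverage (L : FirstOrder.Language.{u, v}) {𝕄 : Type w} [L.Structure 𝕄] {I γ : Type*}
    (U : Ultrafilter I) (t : I → γ → 𝕄) (A : Set 𝕄) (g : γ → 𝕄) : Prop :=
  ∀ φ : L.Formula (γ ⊕ A), φ.Realize (Sum.elim g ((↑) : A → 𝕄)) ↔
    ∀ᶠ i in U, φ.Realize (Sum.elim (t i) ((↑) : A → 𝕄))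

variable {I γ : Type*} {U : Ultrafilter I} {t : I → γ → 𝕄} {A : Set 𝕄} {g : γ → 𝕄}

theorem RealizesAverage.realize_iff {δ : Type*} (h : RealizesAverage L U t A g)
    (φ : L.Formula (γ ⊕ δ)) {p : δ → 𝕄} (hp : ∀ z, p z ∈ A) :
    φ.Realize (Sum.elim g p) ↔ ∀ᶠ i in U, φ.Realize (Sum.elim (t i) p) := by
  simp only [← realize_map_coe φ hp]
  exact h _

theorem RealizesAverage.mono {B : Set 𝕄} (h : RealizesAverage L U t B g) (hAB : A ⊆ B) :
    RealizesAverage L U t A g :=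
  fun φ => h.realize_iff φ fun z => hAB z.2

theorem RealizesAverage.comp {γ' : Type*} (h : RealizesAverage L U t A g) (f : γ' → γ) :
    RealizesAverage L U (fun i => t i ∘ f) A (g ∘ f) := by
  intro φ
  have := h (φ.relabel (Sum.map f id))
  simpa only [Formula.realize_relabel, Sum.elim_comp_map, Function.comp_id] using this

theorem RealizesAverage.sameType {g' : γ → 𝕄} (h : RealizesAverage L U t A g)
    (h' : RealizesAverage L U t A g') : SameType L A g g' :=
  fun φ => (h φ).trans (h' φ).symm

/-- Finitely many formulas true for `U`-almost all `t i` are realized by one `t i`, so saturation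
applies; as `U` is an ultrafilter, the resulting type is complete. -/
theorem IsMonster.exists_realizesAverage (h𝕄 : IsMonster L 𝕄 κ) (hγ : IsSmall κ γ)
    (hA : IsSmall κ A) (U : Ultrafilter I) (t : I → γ → 𝕄) :
    ∃ g, RealizesAverage L U t A g := by
  obtain ⟨g, hg⟩ := h𝕄.exists_realize hγ hA
    {φ | ∀ᶠ i in U, φ.Realize (Sum.elim (t i) ((↑) : A → 𝕄))} (by
      intro s hs
      obtain ⟨i, hi⟩ := ((Filter.eventually_all_finset s).2 fun φ hφ => hs hφ).exists
      exact ⟨t i, hi⟩)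
  refine ⟨g, fun φ => ⟨fun h => ?_, fun h => hg φ h⟩⟩
  by_contra hn
  rw [← Ultrafilter.eventually_not] at hn
  exact hg φ.not (by simpa using hn) h

/-- The tuples with entries in an elementary substructure `M` approximate every type over `M`. -/
theorem exists_ultrafilter_coheir [Nonempty 𝕄] (M : L.ElementarySubstructure 𝕄) (e : γ → 𝕄) :
    ∃ W : Ultrafilter (γ → M), RealizesAverage L W (fun t z => (t z : 𝕄)) M e := by
  let S : L.Formula (γ ⊕ M) → Set (γ → M) := fun θ =>
    {t | θ.Realize (Sum.elim (fun z => (t z : 𝕄)) ((↑) : M → 𝕄))}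
  let F : Filter (γ → M) :=
    ⨅ θ : {θ : L.Formula (γ ⊕ M) // θ.Realize (Sum.elim e ((↑) : M → 𝕄))}, Filter.principal (S θ)
  have hS : ∀ θ : {θ : L.Formula (γ ⊕ M) // θ.Realize (Sum.elim e ((↑) : M → 𝕄))},
      (S θ).Nonempty := by
    rintro ⟨θ, hθ⟩
    obtain ⟨t, ht⟩ := exists_realize_of_elementaryEmbedding M.subtype θ id e hθ
    refine ⟨t, ?_⟩
    rw [← M.subtype.map_formula] at ht
    have key : (M.subtype ∘ Sum.elim t id : γ ⊕ M → 𝕄) =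
        Sum.elim (fun z => (t z : 𝕄)) ((↑) : M → 𝕄) := by
      funext z
      rcases z with z | z <;> rfl
    rwa [key] at ht
  have : F.NeBot := by
    have : Nonempty {θ : L.Formula (γ ⊕ M) // θ.Realize (Sum.elim e ((↑) : M → 𝕄))} :=
      ⟨⟨⊤, by simp⟩⟩
    refine Filter.iInf_neBot_of_directed' ?_ fun θ => Filter.principal_neBot_iff.2 (hS θ)
    rintro ⟨θ, hθ⟩ ⟨θ', hθ'⟩
    refine ⟨⟨θ ⊓ θ', by simpa using ⟨hθ, hθ'⟩⟩, ?_, ?_⟩ <;>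
    · simp only [ge_iff_le, Filter.le_principal_iff, Filter.mem_principal, S]
      intro t ht
      have := Formula.realize_inf.1 ht
      first | exact this.1 | exact this.2
  have key : ∀ θ : L.Formula (γ ⊕ M), θ.Realize (Sum.elim e ((↑) : M → 𝕄)) →
      ∀ᶠ t in (Ultrafilter.of F : Filter (γ → M)), θ.Realize (Sum.elim (fun z => (t z : 𝕄)) ((↑) : M → 𝕄)) := by
    intro θ hθ
    exact Ultrafilter.of_le F (Filter.mem_iInf_of_mem ⟨θ, hθ⟩ (Filter.mem_principal_self _))
  refine ⟨Ultrafilter.of F, fun θ => ⟨key θ, fun h => ?_⟩⟩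
  by_contra hn
  have := key θ.not (Formula.realize_not.2 hn)
  simp only [Formula.realize_not] at this
  exact Ultrafilter.eventually_not.1 this h

end MonsterModel

end KimCriterion

universe x y z

namespace KimCriterion

/-! ### Cutting parameter tuples down to finite ones. -/

section RestrictRight

variable {L : FirstOrder.Language.{u, v}}

/-- The number of the variables of `φ(x; y)` among the variables `y`. -/
noncomputable def rightArity {ξ β : Type*} (φ : L.Formula (ξ ⊕ β)) : ℕ :=
  (leftVars (φ.relabel Sum.swap)).card

/-- The variables of `φ(x; y)` among the variables `y`. -/
noncomputable def rightVars {ξ β : Type*} (φ : L.Formula (ξ ⊕ β)) : Fin (rightArity φ) → β :=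
  fun i => ((leftVars (φ.relabel Sum.swap)).equivFin.symm i : β)

/-- The formula `φ(x; y)`, in which the tuple `y` is cut down to the variables that occur. -/
noncomputable def restrictRight {ξ β : Type*} (φ : L.Formula (ξ ⊕ β)) :
    L.Formula (ξ ⊕ Fin (rightArity φ)) :=
  (restrictLeft (φ.relabel Sum.swap)).relabel
    (Sum.elim (fun y => Sum.inr ((leftVars (φ.relabel Sum.swap)).equivFin y)) Sum.inl)

theorem realize_restrictRight {N : Type*} [L.Structure N] {ξ β : Type*} (φ : L.Formula (ξ ⊕ β))
    (a : ξ → N) (b : β → N) :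
    (restrictRight φ).Realize (Sum.elim a (b ∘ rightVars φ)) ↔ φ.Realize (Sum.elim a b) := by
  have h := realize_restrictLeft (φ.relabel Sum.swap) b a
  rw [Formula.realize_relabel] at h
  have h1 : (Sum.elim b a ∘ Sum.swap : ξ ⊕ β → N) = Sum.elim a b := by
    funext z
    rcases z with z | z <;> rfl
  rw [h1] at h
  rw [← h, restrictRight, Formula.realize_relabel]
  refine iff_of_eq (congrArg _ ?_)
  funext z
  rcases z with z | z
  · exact congrArg (fun y => b (Subtype.val y))
      ((leftVars (φ.relabel Sum.swap)).equivFin.symm_apply_apply z)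
  · rfl

end RestrictRight

/-! ### Global types, invariance and average types. -/

section GlobalTypes

variable {L : FirstOrder.Language.{u, v}} {𝕄 : Type w} [L.Structure 𝕄]

theorem realize_inst_of_models {N : Type*} [L.Structure N] [L[[𝕄]].Structure N]
    [(L.lhomWithConstants 𝕄).IsExpansionOn N] [N ⊨ L.elementaryDiagram 𝕄] {ι β : Type*}
    (φ : L.Formula (ι ⊕ β)) (b : β → 𝕄) (a : ι → N) :
    (inst φ b).Realize a ↔
      φ.Realize (Sum.elim a (ElementaryEmbedding.ofModelsElementaryDiagram L 𝕄 N ∘ b)) := by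
  unfold inst
  rw [Formula.Realize, ← BoundedFormula.realize_constantsVarsEquiv, Equiv.apply_symm_apply]
  refine (Formula.realize_relabel (φ := φ)).trans ?_
  refine iff_of_eq (congrArg _ ?_)
  funext i
  rcases i with i | i <;> rfl

/-- A global type is realized in an elementary extension of the monster model. -/
theorem GlobalType.exists_realization {ι : Type x} (q : GlobalType L 𝕄 ι) :
    ∃ (N : Type (max u v w x)) (_ : L.Structure N) (f : 𝕄 ↪ₑ[L] N) (a : ι → N),
      (∀ (β : Type y) (φ : L.Formula (ι ⊕ β)) (b : β → 𝕄),
        q.Has φ b ↔ φ.Realize (Sum.elim a (f ∘ b))) ∧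
      (∀ (β : Type z) (φ : L.Formula (ι ⊕ β)) (b : β → 𝕄),
        q.Has φ b ↔ φ.Realize (Sum.elim a (f ∘ b))) := by
  obtain ⟨N, a, ha⟩ := Theory.exists_modelType_is_realized_in _ q
  let _ : L.Structure N := (L.lhomWithConstants 𝕄).reduct N
  have : (L.lhomWithConstants 𝕄).IsExpansionOn N := LHom.isExpansionOn_reduct _ _
  -- The two clauses let one realization serve parameter tuples from two universes.
  refine ⟨N, inferInstance, ElementaryEmbedding.ofModelsElementaryDiagram L 𝕄 N, a, ?_, ?_⟩ <;>
  · intro β φ b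
    rw [← realize_inst_of_models, GlobalType.Has, ← ha]
    exact Theory.CompleteType.formula_mem_typeOf

theorem GlobalType.has_relabel {ι β δ : Type*} (q : GlobalType L 𝕄 ι) (φ : L.Formula (ι ⊕ β))
    (f : β → δ) (b : δ → 𝕄) :
    q.Has (φ.relabel (Sum.map id f)) b ↔ q.Has φ (b ∘ f) := by
  obtain ⟨N, _, g, a, h, h'⟩ := q.exists_realization
  rw [h, h', Formula.realize_relabel, Sum.elim_comp_map]
  rfl

theorem GlobalType.has_restrictRight {ι β : Type*} (q : GlobalType L 𝕄 ι) (φ : L.Formula (ι ⊕ β))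
    (b : β → 𝕄) : q.Has (restrictRight φ) (b ∘ rightVars φ) ↔ q.Has φ b := by
  obtain ⟨N, _, g, a, h, h'⟩ := q.exists_realization
  rw [h, h', ← Function.comp_assoc, realize_restrictRight]

theorem GlobalType.has_not {ι β : Type*} (q : GlobalType L 𝕄 ι) (φ : L.Formula (ι ⊕ β))
    (b : β → 𝕄) : q.Has φ.not b ↔ ¬ q.Has φ b := by
  obtain ⟨N, _, g, a, h, -⟩ := GlobalType.exists_realization.{u, v, w, _, _, 0} q
  rw [h, h, Formula.realize_not]

theorem GlobalType.exists_realize [Nonempty 𝕄] {ι β : Type*} (q : GlobalType L 𝕄 ι)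
    (s : Finset (L.Formula (ι ⊕ β))) (b : β → 𝕄) (hs : ∀ φ ∈ s, q.Has φ b) :
    ∃ a : ι → 𝕄, ∀ φ ∈ s, φ.Realize (Sum.elim a b) := by
  obtain ⟨N, _, g, a, h, -⟩ := GlobalType.exists_realization.{u, v, w, _, _, 0} q
  obtain ⟨a', ha'⟩ := exists_realize_of_elementaryEmbedding g
    (Formula.iInf fun φ : s => φ.1) b a (by
      rw [Formula.realize_iInf]
      exact fun φ => (h _ _ _).1 (hs φ.1 φ.2))
  rw [Formula.realize_iInf] at ha'
  exact ⟨a', fun φ hφ => ha' ⟨φ, hφ⟩⟩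

theorem GlobalType.RealizedOver.has_iff {ι δ : Type*} {q : GlobalType L 𝕄 ι} {A : Set 𝕄}
    {a : ι → 𝕄} (h : q.RealizedOver A a) (φ : L.Formula (ι ⊕ δ)) {p : δ → 𝕄}
    (hp : ∀ z, p z ∈ A) : q.Has φ p ↔ φ.Realize (Sum.elim a p) := by
  rw [← realize_map_coe φ hp, ← h, GlobalType.has_relabel]
  rfl

theorem GlobalType.RealizedOver.mono {ι : Type*} {q : GlobalType L 𝕄 ι} {A B : Set 𝕄}
    {a : ι → 𝕄} (h : q.RealizedOver B a) (hAB : A ⊆ B) : q.RealizedOver A a :=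
  fun φ => h.has_iff φ fun z => hAB z.2

theorem GlobalType.RealizedOver.sameType {ι : Type*} {q q' : GlobalType L 𝕄 ι} {A : Set 𝕄}
    {a a' b : ι → 𝕄} (h : q.RealizedOver A a) (h' : q'.RealizedOver A a')
    (hb : q.RealizedOver A b) (hb' : q'.RealizedOver A b) : SameType L A a a' :=
  fun φ => (((h φ).symm.trans (hb φ)).trans (hb' φ).symm).trans (h' φ)

/-- Invariance is stated for finite parameter tuples; a formula uses only finitely many of its
variables, so it extends to infinite ones. -/
theorem GlobalType.IsInvariant.has_iff {ι δ : Type*} {q : GlobalType L 𝕄 ι} {A : Set 𝕄}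
    (hq : q.IsInvariant A) (φ : L.Formula (ι ⊕ δ)) {b b' : δ → 𝕄} (h : SameType L A b b') :
    q.Has φ b ↔ q.Has φ b' := by
  rw [← q.has_restrictRight φ, ← q.has_restrictRight φ]
  exact hq _ _ _ _ (h.comp _)

theorem IsMonster.exists_realizedOver {κ : Cardinal.{w}} (h𝕄 : IsMonster L 𝕄 κ) [Nonempty 𝕄]
    {ι : Type*} (hι : IsSmall κ ι) (q : GlobalType L 𝕄 ι) {A : Set 𝕄} (hA : IsSmall κ A) :
    ∃ a, q.RealizedOver A a := by
  obtain ⟨a, ha⟩ := h𝕄.exists_realize hι hA {φ | q.Has φ ((↑) : A → 𝕄)}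
    fun s hs => q.exists_realize s _ hs
  refine ⟨a, fun φ => ⟨fun h => ha φ h, fun h => ?_⟩⟩
  by_contra hn
  exact ha φ.not ((q.has_not _ _).2 hn) h

/-- Realizations of an invariant type over conjugate tuples extend these to conjugate tuples. -/
theorem SameType.sum_realizedOver {δ ι : Type*} {q : GlobalType L 𝕄 ι} {A B B' : Set 𝕄}
    (hq : q.IsInvariant A) {b b' : δ → 𝕄} (h : SameType L A b b') {a a' : ι → 𝕄}
    (ha : q.RealizedOver B a) (ha' : q.RealizedOver B' a') (hB : A ∪ Set.range b ⊆ B)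
    (hB' : A ∪ Set.range b' ⊆ B') :
    SameType L A (Sum.elim b a) (Sum.elim b' a') := by
  intro φ
  let f : (δ ⊕ ι) ⊕ A → ι ⊕ (δ ⊕ A) :=
    Sum.elim (Sum.elim (fun z => Sum.inr (Sum.inl z)) Sum.inl) fun z => Sum.inr (Sum.inr z)
  have key : ∀ (c : δ → 𝕄) (d : ι → 𝕄), φ.Realize (Sum.elim (Sum.elim c d) ((↑) : A → 𝕄)) ↔
      (φ.relabel f).Realize (Sum.elim d (Sum.elim c ((↑) : A → 𝕄))) := by
    intro c d
    rw [Formula.realize_relabel]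
    refine iff_of_eq (congrArg _ ?_)
    funext z
    rcases z with (z | z) | z <;> rfl
  rw [key, key, ← ha.has_iff, ← ha'.has_iff]
  · refine hq.has_iff _ fun ψ => ?_
    let g : (δ ⊕ A) ⊕ A → δ ⊕ A := Sum.elim id Sum.inr
    have key' : ∀ c : δ → 𝕄, ψ.Realize (Sum.elim (Sum.elim c ((↑) : A → 𝕄)) ((↑) : A → 𝕄)) ↔
        (ψ.relabel g).Realize (Sum.elim c ((↑) : A → 𝕄)) := by
      intro c
      rw [Formula.realize_relabel]
      refine iff_of_eq (congrArg _ ?_)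
      funext z
      rcases z with (z | z) | z <;> rfl
    rw [key', key']
    exact h _
  · rintro (z | z)
    · exact hB' (Or.inr ⟨z, rfl⟩)
    · exact hB' (Or.inl z.2)
  · rintro (z | z)
    · exact hB (Or.inr ⟨z, rfl⟩)
    · exact hB (Or.inl z.2)

/-- The average along an ultrafilter of tuples from `𝕄` as a global type. -/
theorem exists_globalType_average [Nonempty 𝕄] {I ι : Type*} (U : Ultrafilter I)
    (t : I → ι → 𝕄) :
    ∃ q : GlobalType L 𝕄 ι,
      (∀ A : Set 𝕄, (∀ i z, t i z ∈ A) → q.IsInvariant A) ∧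
      (∀ A a, q.RealizedOver A a ↔ RealizesAverage L U t A a) := by
  let P := (U : Filter I).Product fun _ : I => 𝕄
  let _ : L[[𝕄]].Structure P := Ultraproduct.structure
  have hP : P ⊨ L.elementaryDiagram 𝕄 := by
    refine ⟨fun φ hφ => ?_⟩
    rw [Ultraproduct.sentence_realize]
    exact Filter.Eventually.of_forall fun _ => hφ
  -- The global type is that of the class of `t` in the ultrapower of `𝕄`; Łoś's theorem computes
  -- it.
  let a : ι → P := fun z => Quotient.mk _ fun i => t i z
  let q : GlobalType L 𝕄 ι := (L.elementaryDiagram 𝕄).typeOf a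
  have hq : ∀ {β : Type w} (φ : L.Formula (ι ⊕ β)) (b : β → 𝕄),
      q.Has φ b ↔ ∀ᶠ i in U, φ.Realize (Sum.elim (t i) b) := by
    intro β φ b
    refine Theory.CompleteType.formula_mem_typeOf.trans ?_
    refine (Ultraproduct.realize_formula_cast (inst φ b) fun z i => t i z).trans ?_
    exact Filter.eventually_congr (Filter.Eventually.of_forall fun i => realize_inst φ b _)
  refine ⟨q, fun A hA m φ b b' hb => ?_, fun A a => ?_⟩
  · have key : ∀ c : Fin m → 𝕄, q.Has φ c ↔ ∀ᶠ i in U, φ.Realize (Sum.elim (t i) c) := by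
      intro c
      have h := hq (φ.relabel (Sum.map id (fun z => ULift.up.{w} z))) (c ∘ ULift.down)
      rw [GlobalType.has_relabel] at h
      refine h.trans (Filter.eventually_congr (Filter.Eventually.of_forall fun i => ?_))
      rw [Formula.realize_relabel, Sum.elim_comp_map]
      rfl
    rw [key, key]
    refine Filter.eventually_congr (Filter.Eventually.of_forall fun i => ?_)
    have h := hb.realize_iff (φ.relabel Sum.swap) (hA i)
    simp only [Formula.realize_relabel] at h
    have hswap : ∀ c : Fin m → 𝕄, Sum.elim c (t i) ∘ Sum.swap = Sum.elim (t i) c := by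
      intro c
      funext z
      rcases z with z | z <;> rfl
    rwa [hswap, hswap] at h
  · exact forall_congr' fun φ => ⟨fun h => h.symm.trans (hq _ _), fun h => (hq _ _).trans h.symm⟩

end GlobalTypes

/-! ### Independence of averages, and the core contradiction. -/

section Independence

variable {L : FirstOrder.Language.{u, v}} {𝕄 : Type w} [L.Structure 𝕄] {κ : Cardinal.{w}}
  {Ind : Set 𝕄 → Set 𝕄 → Set 𝕄 → Prop}

/-- The properties of the relation `Ind` which are assumed throughout. -/
structure IsIndependence (L : FirstOrder.Language.{u, v}) {𝕄 : Type w} [L.Structure 𝕄]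
    (κ : Cardinal.{w}) (Ind : Set 𝕄 → Set 𝕄 → Set 𝕄 → Prop) : Prop where
  invariance : Invariance L κ Ind
  strongFiniteCharacter : StrongFiniteCharacter L κ Ind
  existence : ExistenceOverModels L κ Ind
  monotonicity : Monotonicity L κ Ind
  symmetry : Symmetry L κ Ind
  independenceTheorem : IndependenceTheorem L κ Ind

variable {M : L.ElementarySubstructure 𝕄}

theorem IsIndependence.mono (hI : IsIndependence L κ Ind) (hM : IsSmall κ M) {A A' B B' : Set 𝕄}
    (h : Ind A' M B') (hA' : IsSmall κ A') (hB' : IsSmall κ B') (hA : A ⊆ A') (hB : B ⊆ B') :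
    Ind A M B := by
  have := hI.monotonicity M hM.lt A A' B B' (hA'.mono hA).lt hA'.lt (hB'.mono hB).lt hB'.lt
    (↑) (↑) (↑) (↑)
  simp only [Subtype.range_coe] at this
  rw [Set.union_eq_self_of_subset_left hA, Set.union_eq_self_of_subset_left hB] at this
  exact this h

theorem IsIndependence.symm (hI : IsIndependence L κ Ind) (hM : IsSmall κ M) {A B : Set 𝕄}
    (h : Ind A M B) (hA : IsSmall κ A) (hB : IsSmall κ B) : Ind B M A := by
  have := hI.symmetry M hM.lt A B hA.lt hB.lt (↑) (↑)
  simp only [Subtype.range_coe] at this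
  exact this.1 h

theorem IsIndependence.image (hI : IsIndependence L κ Ind) (hM : IsSmall κ M) {A B : Set 𝕄}
    (h : Ind A M B) (hA : IsSmall κ A) (hB : IsSmall κ B) (σ : 𝕄 ≃[L] 𝕄)
    (hσ : ∀ x ∈ M, σ x = x) : Ind (σ '' A) M (σ '' B) := by
  have := (hI.invariance σ A M B hA.lt hM.lt hB.lt).1 h
  rwa [show σ '' (M : Set 𝕄) = M from (Set.image_congr hσ).trans (Set.image_id' _)] at this

/-- A formula witnessing dependence would hold of some `t i`. But `t i` lies in `M`, and existence
with symmetry makes `M` independent from `B`. -/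
theorem IsIndependence.of_realizesAverage (hI : IsIndependence L κ Ind)
    (hM : IsSmall κ M) {I γ : Type*} {U : Ultrafilter I} {t : I → γ → 𝕄}
    (ht : ∀ i z, t i z ∈ M) {B : Set 𝕄} (hB : IsSmall κ B) {g : γ → 𝕄} (hγ : IsSmall κ γ)
    (hg : RealizesAverage L U t (M ∪ B) g) : Ind (Set.range g) M B := by
  by_contra hn
  let s : Set.range g → γ := fun x => x.2.choose
  have hs : ∀ x, g (s x) = x := fun x => x.2.choose_spec
  have hgs : g ∘ s = ((↑) : Set.range g → 𝕄) := funext hs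
  have h1 := hI.strongFiniteCharacter M hM.lt (Set.range g) B (hγ.range g).lt hB.lt (↑) (↑)
  simp only [Subtype.range_coe] at h1
  obtain ⟨φ, hφ, hφ'⟩ := h1 hn
  have h2 := (hg.comp s).realize_iff φ (p := Sum.elim ((↑) : B → 𝕄) ((↑) : M → 𝕄)) (by
    rintro (z | z)
    · exact Or.inr z.2
    · exact Or.inl z.2)
  rw [hgs] at h2
  obtain ⟨i, hi⟩ := (h2.1 hφ).exists
  have h3 := hI.existence M hM.lt B hB.lt (↑)
  simp only [Subtype.range_coe] at h3
  refine hφ' _ hi (hI.mono hM (hI.symm hM h3 hB hM) hM hB ?_ subset_rfl)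
  rintro _ ⟨z, rfl⟩
  exact ht i _

theorem IsIndependence.amalgam (hI : IsIndependence L κ Ind) (hM : IsSmall κ M) {ξ : Type*}
    (hξ : IsSmall κ ξ) {a a' : ξ → 𝕄} {B C : Set 𝕄} (hB : IsSmall κ B) (hC : IsSmall κ C)
    (h : Ind (Set.range a) M B) (h' : Ind (Set.range a') M C) (hBC : Ind B M C)
    (haa' : SameType L (M : Set 𝕄) a a') :
    ∃ a'' : ξ → 𝕄, SameType L (M ∪ B) a'' a ∧ SameType L (M ∪ C) a'' a' ∧
      Ind (Set.range a'') M (B ∪ C) := by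
  obtain ⟨ξ', hξ', ⟨e⟩⟩ := hξ
  have := hI.independenceTheorem M hM.lt ξ' B C hξ' hB.lt hC.lt (a ∘ e.symm) (a' ∘ e.symm) (↑) (↑)
  simp only [Subtype.range_coe, e.symm.surjective.range_comp] at this
  obtain ⟨a'', h1, h2, h3⟩ := this h h' hBC (haa'.comp _)
  refine ⟨a'' ∘ e, ?_, ?_, ?_⟩
  · simpa [Function.comp_assoc] using h1.comp e
  · simpa [Function.comp_assoc] using h2.comp e
  · rwa [e.surjective.range_comp]

/-- There are no two sequences with the same average over a model containing them, such that
`φ(x; y)` is consistent along the first one, but not even with a later member of it along the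
second one. -/
theorem IsIndependence.false_of_averages (hI : IsIndependence L κ Ind) (h𝕄 : IsMonster L 𝕄 κ)
    [Nonempty 𝕄] (hM : IsSmall κ M) {ξ β : Type*} (hξ : IsSmall κ ξ) (hβ : IsSmall κ β)
    (φ : L.Formula (ξ ⊕ β)) (d₀ d₁ : ℕ → β → 𝕄) (hd₀ : ∀ i z, d₀ i z ∈ M)
    (hd₁ : ∀ i z, d₁ i z ∈ M)
    (heq : ∀ θ : L.Formula (β ⊕ M), ∃ n, ∀ i ≥ n,
      (θ.Realize (Sum.elim (d₀ i) ((↑) : M → 𝕄)) ↔ θ.Realize (Sum.elim (d₁ i) ((↑) : M → 𝕄))))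
    (a : ξ → 𝕄) (ha : ∀ i, φ.Realize (Sum.elim a (d₀ i)))
    (hinc : ∀ i j, i < j →
      ¬ ∃ x : ξ → 𝕄, φ.Realize (Sum.elim x (d₁ i)) ∧ φ.Realize (Sum.elim x (d₀ j))) : False := by
  have hκ := h𝕄.aleph0_lt
  let U : Ultrafilter ℕ := Filter.hyperfilter ℕ
  have hU : ∀ n : ℕ, ∀ᶠ i in U, n ≤ i := fun n =>
    (Nat.hyperfilter_le_atTop) (Filter.eventually_ge_atTop n)
  -- The order of choice matters. As `g₁` is chosen over `g₀`, a statement about both is reflected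
  -- by first replacing `g₁` with some `d₁ i`, and then `g₀` with some `d₀ j`, where `j > i` because
  -- `U` is nonprincipal.
  obtain ⟨g₀, hg₀⟩ := h𝕄.exists_realizesAverage hβ (hM.union hκ (hξ.range a)) U d₀
  obtain ⟨g₁, hg₁⟩ := h𝕄.exists_realizesAverage hβ (hM.union hκ (hβ.range g₀)) U d₁
  have ha₀ : Ind (Set.range a) M (Set.range g₀) :=
    hI.symm hM (hI.of_realizesAverage hM hd₀ (hξ.range a) hβ hg₀) (hβ.range g₀) (hξ.range a)
  have h₀₁ : Ind (Set.range g₀) M (Set.range g₁) :=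
    hI.symm hM (hI.of_realizesAverage hM hd₁ (hβ.range g₀) hβ hg₁) (hβ.range g₁) (hβ.range g₀)
  have hsame : SameType L (M : Set 𝕄) g₀ g₁ := by
    intro θ
    rw [hg₀.realize_iff θ fun z => Or.inl z.2, hg₁.realize_iff θ fun z => Or.inl z.2]
    obtain ⟨n, hn⟩ := heq θ
    refine Filter.eventually_congr ?_
    filter_upwards [hU n] with i hi
    exact hn i hi
  obtain ⟨σ, hσM, hσ⟩ := h𝕄.exists_equiv hβ hM hsame
  have hσg : σ ∘ g₀ = g₁ := funext hσ
  have ha₁ : Ind (Set.range (σ ∘ a)) M (Set.range g₁) := by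
    have := hI.image hM ha₀ (hξ.range a) (hβ.range g₀) σ hσM
    rwa [← Set.range_comp, ← Set.range_comp, hσg] at this
  obtain ⟨x, hx₀, hx₁, -⟩ := hI.amalgam hM hξ (hβ.range g₀) (hβ.range g₁) ha₀ ha₁ h₀₁
    (sameType_of_equiv σ hσM a)
  have h0 : φ.Realize (Sum.elim a g₀) := by
    have := (hg₀.realize_iff (φ.relabel Sum.swap) (p := a) fun z => Or.inr ⟨z, rfl⟩).2
      (Filter.Eventually.of_forall fun i => by
        rw [Formula.realize_relabel]
        convert ha i using 1
        funext z
        rcases z with z | z <;> rfl)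
    rw [Formula.realize_relabel] at this
    convert this using 1
    funext z
    rcases z with z | z <;> rfl
  have h1 : φ.Realize (Sum.elim (σ ∘ a) g₁) := by
    rw [← hσg, ← Sum.comp_elim]
    exact (StrongHomClass.realize_formula σ φ).2 h0
  have hx0 : φ.Realize (Sum.elim x g₀) := (hx₀.realize_iff φ fun z => Or.inr ⟨z, rfl⟩).2 h0
  have hx1 : φ.Realize (Sum.elim x g₁) := (hx₁.realize_iff φ fun z => Or.inr ⟨z, rfl⟩).2 h1
  let ψ : L.Formula (ξ ⊕ (β ⊕ β)) :=
    φ.relabel (Sum.map id Sum.inl) ⊓ φ.relabel (Sum.map id Sum.inr)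
  have hψ : ∀ b c : β → 𝕄, (exLeft ψ).Realize (Sum.elim b c) ↔
      ∃ x : ξ → 𝕄, φ.Realize (Sum.elim x b) ∧ φ.Realize (Sum.elim x c) := by
    intro b c
    rw [realize_exLeft]
    refine exists_congr fun x => ?_
    rw [Formula.realize_inf, Formula.realize_relabel, Formula.realize_relabel]
    simp only [Sum.elim_comp_map, Sum.elim_comp_inl, Sum.elim_comp_inr, Function.comp_id]
  have h01 := (hg₁.realize_iff (exLeft ψ) (p := g₀) fun z => Or.inr ⟨z, rfl⟩).1
    ((hψ _ _).2 ⟨x, hx1, hx0⟩)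
  obtain ⟨i, hi⟩ := h01.exists
  have h0i := (hg₀.realize_iff ((exLeft ψ).relabel Sum.swap) (p := d₁ i)
    fun z => Or.inl (hd₁ i z)).1 (by
      rw [Formula.realize_relabel]
      convert hi using 1
      funext z
      rcases z with z | z <;> rfl)
  obtain ⟨j, hj, hij⟩ := (h0i.and (hU (i + 1))).exists
  rw [Formula.realize_relabel] at hj
  refine hinc i j hij ((hψ _ _).1 ?_)
  convert hj using 1
  funext z
  rcases z with z | z <;> rfl

end Independence

/-! ### Small elementary substructures and their unions. -/

section SmallModels

variable {L : FirstOrder.Language.{u, v}} {𝕄 : Type w} [L.Structure 𝕄] {κ : Cardinal.{w}}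

/-- A single bound `μ` for all models of a countable chain keeps their union small, whatever the
cofinality of `κ`. -/
theorem IsMonster.exists_card (h𝕄 : IsMonster L 𝕄 κ) :
    ∃ μ : Cardinal.{w}, μ < κ ∧ ℵ₀ ≤ μ ∧
      Cardinal.lift.{w} L.card ≤ Cardinal.lift.{max u v} μ := by
  obtain ⟨μ, hμ⟩ := Cardinal.mem_range_lift_of_le h𝕄.card_lt.le
  refine ⟨max μ ℵ₀, max_lt ?_ h𝕄.aleph0_lt, le_max_right _ _, ?_⟩
  · have := h𝕄.card_lt
    rw [← hμ] at this
    exact Cardinal.lift_lt.1 this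
  · rw [← hμ]
    exact Cardinal.lift_le.2 (le_max_left _ _)

theorem exists_elementarySubstructure_card_le {μ : Cardinal.{w}} (hμ : ℵ₀ ≤ μ)
    (hL : Cardinal.lift.{w} L.card ≤ Cardinal.lift.{max u v} μ) (S : Set 𝕄) (hS : #S ≤ μ) :
    ∃ N : L.ElementarySubstructure 𝕄, S ⊆ N ∧ #N ≤ μ := by
  by_cases h : μ ≤ #𝕄
  · obtain ⟨N, hN, hN'⟩ := exists_elementarySubstructure_card_eq L S μ hμ
      (Cardinal.lift_le.2 hS) hL (Cardinal.lift_le.2 h)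
    exact ⟨N, hN, (Cardinal.lift_injective hN').le⟩
  -- If `𝕄` has fewer than `μ` elements, it serves as the model itself.
  · exact ⟨⊤, Set.subset_univ _, (Cardinal.mk_set_le _).trans (le_of_not_ge h)⟩

/-- Tarski–Vaught: a definable set has finitely many parameters, which already lie in one member of
the chain. -/
theorem exists_elementarySubstructure_iUnion (N : ℕ → L.ElementarySubstructure 𝕄)
    (hN : Monotone fun n => (N n : Set 𝕄)) :
    ∃ M : L.ElementarySubstructure 𝕄, (M : Set 𝕄) = ⋃ n, (N n : Set 𝕄) := by
  have h : L.MeetsDefinable (⋃ n, (N n : Set 𝕄)) := by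
    intro D hD hdef
    obtain ⟨A₀, hA₀, hdef'⟩ := Set.definable_iff_finitely_definable.1 hdef
    obtain ⟨n, hn⟩ : ∃ n, (A₀ : Set 𝕄) ⊆ N n :=
      (hN.directed_le.exists_mem_subset_of_finset_subset_biUnion (s := A₀) (by simpa using hA₀))
    obtain ⟨x, hx, hx'⟩ := (N n).meetsDefinable D hD (hdef'.mono hn)
    exact ⟨x, hx, Set.mem_iUnion.2 ⟨n, hx'⟩⟩
  exact ⟨h.toElementarySubstructure, h.closure_eq_self⟩

end SmallModels

/-! ### Joint consistency of instances under averages. -/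

section Averages

variable {L : FirstOrder.Language.{u, v}} {𝕄 : Type w} [L.Structure 𝕄] {κ : Cardinal.{w}}

theorem RealizesAverage.exists_iff [Nonempty 𝕄] {I K ξ β : Type*} {U : Ultrafilter I}
    {t : I → K → β → 𝕄} {A : Set 𝕄} {g : K → β → 𝕄}
    (h : RealizesAverage L U (fun i (z : K × β) => t i z.1 z.2) A fun z => g z.1 z.2)
    (φ : L.Formula (ξ ⊕ β)) (s : Finset K) (P : Finset (β → 𝕄)) (hP : ∀ p ∈ P, ∀ z, p z ∈ A) :
    (∃ x : ξ → 𝕄, (∀ k ∈ s, φ.Realize (Sum.elim x (g k))) ∧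
        ∀ p ∈ P, φ.Realize (Sum.elim x p)) ↔
      ∀ᶠ i in U, ∃ x : ξ → 𝕄, (∀ k ∈ s, φ.Realize (Sum.elim x (t i k))) ∧
        ∀ p ∈ P, φ.Realize (Sum.elim x p) := by
  classical
  let θ : L.Formula ((K × β) ⊕ (P × β)) :=
    (consOver φ (s.disjSum (Finset.univ : Finset P))).relabel (Equiv.sumProdDistrib _ _ _)
  have key : ∀ c : K → β → 𝕄,
      θ.Realize (Sum.elim (fun z => c z.1 z.2) fun z => z.1.1 z.2) ↔
      ∃ x : ξ → 𝕄, (∀ k ∈ s, φ.Realize (Sum.elim x (c k))) ∧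
        ∀ p ∈ P, φ.Realize (Sum.elim x p) := by
    intro c
    have h1 : (Sum.elim (fun z : K × β => c z.1 z.2) fun z : P × β => z.1.1 z.2) ∘
        (Equiv.sumProdDistrib K P β) =
        fun z => (Sum.elim c Subtype.val : K ⊕ P → β → 𝕄) z.1 z.2 := by
      funext z
      obtain ⟨z | z, y⟩ := z <;> rfl
    rw [Formula.realize_relabel, h1, realize_consOver]
    simp
  rw [← key, h.realize_iff θ fun z => hP _ z.1.2 z.2]
  exact Filter.eventually_congr (Filter.Eventually.of_forall fun i => key _)

end Averages

/-! ### Extracting two sequences from an SOP₁ tree. -/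

section Trees

variable {L : FirstOrder.Language.{u, v}} {𝕄 : Type w} [L.Structure 𝕄] {κ : Cardinal.{w}}
  {ξ β : Type*} (φ : L.Formula (ξ ⊕ β))

/-- The tree of tuples `t` witnesses that `φ` has SOP₁. -/
structure IsSOP1Tree {N : Type*} [L.Structure N] (t : List Bool → β → N) : Prop where
  consistent : ∀ ν, ∃ x : ξ → N, ∀ ρ, ρ <+: ν → φ.Realize (Sum.elim x (t ρ))
  inconsistent : ∀ η ν, η ++ [false] <+: ν →
    ¬ ∃ x : ξ → N, φ.Realize (Sum.elim x (t ν)) ∧ φ.Realize (Sum.elim x (t (η ++ [true])))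

/-- A stage of the construction of two sequences out of a tree witnessing SOP₁: a model, a tree,
and the members of the two sequences which were chosen before. -/
structure TreeStage (L : FirstOrder.Language.{u, v}) (𝕄 : Type w) [L.Structure 𝕄] (β : Type*) where
  model : L.ElementarySubstructure 𝕄
  tree : List Bool → β → 𝕄
  pos : Finset (β → 𝕄)
  neg : Finset (β → 𝕄)

/-- The properties of a stage. -/
structure TreeStage.IsGood (μ : Cardinal.{w}) (S : TreeStage L 𝕄 β) : Prop where
  card_le : #S.model ≤ μ
  pos_mem : ∀ p ∈ S.pos, ∀ z, p z ∈ S.model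
  neg_mem : ∀ p ∈ S.neg, ∀ z, p z ∈ S.model
  consistent : ∀ ν, ∃ x : ξ → 𝕄, (∀ ρ, ρ <+: ν → φ.Realize (Sum.elim x (S.tree ρ))) ∧
    ∀ p ∈ S.pos, φ.Realize (Sum.elim x p)
  inconsistent : ∀ η ν, η ++ [false] <+: ν →
    ¬ ∃ x : ξ → 𝕄, φ.Realize (Sum.elim x (S.tree ν)) ∧
      φ.Realize (Sum.elim x (S.tree (η ++ [true])))
  inconsistent_neg : ∀ p ∈ S.neg, ∀ ν,
    ¬ ∃ x : ξ → 𝕄, φ.Realize (Sum.elim x (S.tree ν)) ∧ φ.Realize (Sum.elim x p)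

variable {φ}

open Classical in
-- The new tree is an average of the subtrees above the nodes `0ᵏ1`. Its root becomes the next
-- positive tuple; the next negative tuple is another realization, over the new tree, of the average
-- of the roots.
theorem TreeStage.IsGood.exists_next [Nonempty 𝕄] (h𝕄 : IsMonster L 𝕄 κ) [Countable β]
    {μ : Cardinal.{w}} (hμκ : μ < κ) (hμ : ℵ₀ ≤ μ)
    (hL : Cardinal.lift.{w} L.card ≤ Cardinal.lift.{max u v} μ) {S : TreeStage L 𝕄 β}
    (hS : S.IsGood φ μ) :
    ∃ (S' : TreeStage L 𝕄 β) (d : Bool → β → 𝕄), S'.IsGood φ μ ∧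
      (S.model : Set 𝕄) ⊆ S'.model ∧ S'.pos = insert (d false) S.pos ∧
      S'.neg = insert (d true) S.neg ∧ SameType L (S.model : Set 𝕄) (d false) (d true) ∧
      ∀ p ∈ S.neg, ¬ ∃ x : ξ → 𝕄, φ.Realize (Sum.elim x p) ∧
        φ.Realize (Sum.elim x (d false)) := by
  have hκ := h𝕄.aleph0_lt
  have hN : IsSmall κ S.model := .of_lt (hS.card_le.trans_lt hμκ)
  let U : Ultrafilter ℕ := Filter.hyperfilter ℕ
  have hU : ∀ n : ℕ, ∀ᶠ i in U, n ≤ i := fun n =>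
    (Nat.hyperfilter_le_atTop) (Filter.eventually_ge_atTop n)
  -- For `j < k`, all of `E k` lies above `0ʲ0`, so each of its nodes conflicts with the root `E j
  -- []` at `0ʲ1`.
  let E : ℕ → List Bool → β → 𝕄 := fun k ν => S.tree (List.replicate k false ++ true :: ν)
  have hEcons : ∀ k ν, ∃ x : ξ → 𝕄, (∀ ρ, ρ <+: ν → φ.Realize (Sum.elim x (E k ρ))) ∧
      ∀ p ∈ S.pos, φ.Realize (Sum.elim x p) := by
    intro k ν
    obtain ⟨x, hx, hx'⟩ := hS.consistent (List.replicate k false ++ true :: ν)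
    refine ⟨x, fun ρ hρ => hx _ ?_, hx'⟩
    simpa using hρ
  have hEinc : ∀ k η ν, η ++ [false] <+: ν → ¬ ∃ x : ξ → 𝕄,
      φ.Realize (Sum.elim x (E k ν)) ∧ φ.Realize (Sum.elim x (E k (η ++ [true]))) := by
    intro k η ν hν
    have := hS.inconsistent (List.replicate k false ++ true :: η)
      (List.replicate k false ++ true :: ν) (by simpa using hν)
    simpa [E] using this
  have hEE : ∀ j k ν, j < k → ¬ ∃ x : ξ → 𝕄,
      φ.Realize (Sum.elim x (E k ν)) ∧ φ.Realize (Sum.elim x (E j [])) := by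
    intro j k ν hjk
    refine hS.inconsistent (List.replicate j false) _ ?_
    obtain ⟨l, rfl⟩ := Nat.exists_eq_add_of_lt hjk
    refine ⟨List.replicate l false ++ true :: ν, ?_⟩
    rw [← List.append_assoc, show [false] = List.replicate 1 false from rfl,
      List.replicate_append_replicate, List.replicate_append_replicate]
    congr 2
    omega
  -- The base includes the old tree, so that the roots `E j []` are allowed as parameters in
  -- `hpair`.
  have hA : IsSmall κ ↥((S.model : Set 𝕄) ∪ Set.range fun z : List Bool × β => S.tree z.1 z.2) :=
    hN.union hκ ((IsSmall.of_countable hκ _).range _)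
  obtain ⟨g, hg⟩ := h𝕄.exists_realizesAverage (IsSmall.of_countable hκ (List Bool × β)) hA U
    fun k z => E k z.1 z.2
  obtain ⟨t, rfl⟩ : ∃ t : List Bool → β → 𝕄, g = fun z => t z.1 z.2 := ⟨fun a b => g (a, b), rfl⟩
  have hB : IsSmall κ ↥((S.model : Set 𝕄) ∪ Set.range fun z : List Bool × β => t z.1 z.2) :=
    hN.union hκ ((IsSmall.of_countable hκ _).range _)
  obtain ⟨g', hg'⟩ := h𝕄.exists_realizesAverage (IsSmall.of_countable hκ (Unit × β)) hB U
    fun k z => E k [] z.2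
  obtain ⟨d, rfl⟩ : ∃ d : Unit → β → 𝕄, g' = fun z => d z.1 z.2 := ⟨fun a b => g' (a, b), rfl⟩
  -- nodes of the new tree are inconsistent with parameters with which the `E k` are inconsistent
  have hpair : ∀ (p : β → 𝕄) (ν : List Bool),
      (∀ z, p z ∈ (S.model : Set 𝕄) ∪ Set.range fun z : List Bool × β => S.tree z.1 z.2) →
      (∀ᶠ k in U, ¬ ∃ x : ξ → 𝕄, φ.Realize (Sum.elim x (E k ν)) ∧ φ.Realize (Sum.elim x p)) →
      ¬ ∃ x : ξ → 𝕄, φ.Realize (Sum.elim x (t ν)) ∧ φ.Realize (Sum.elim x p) := by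
    intro p ν hp hk hx
    have := (hg.exists_iff φ {ν} {p} (by simpa using hp)).1 (by simpa using hx)
    obtain ⟨k, h1, h2⟩ := (this.and hk).exists
    exact h2 (by simpa using h1)
  have hneg : ∀ p ∈ S.neg, ∀ ν, ¬ ∃ x : ξ → 𝕄, φ.Realize (Sum.elim x (t ν)) ∧
      φ.Realize (Sum.elim x p) := fun p hp ν =>
    hpair p ν (fun z => Or.inl (hS.neg_mem p hp z))
      (Filter.Eventually.of_forall fun k => hS.inconsistent_neg p hp _)
  obtain ⟨N, hN, hNμ⟩ := exists_elementarySubstructure_card_le hμ hL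
    ((S.model : Set 𝕄) ∪ (Set.range (t []) ∪ Set.range (d ()))) (by
      refine (Cardinal.mk_union_le _ _).trans (Cardinal.add_le_of_le hμ hS.card_le ?_)
      refine (Cardinal.mk_union_le _ _).trans (Cardinal.add_le_of_le hμ ?_ ?_) <;>
      exact (Cardinal.mk_le_aleph0_iff.2 (Set.countable_range _).to_subtype).trans hμ)
  have hNm : (S.model : Set 𝕄) ⊆ N := Set.subset_union_left.trans hN
  refine ⟨⟨N, t, insert (t []) S.pos, insert (d ()) S.neg⟩, fun b => bif b then d () else t [],
    ⟨hNμ, ?_, ?_, ?_, ?_, ?_⟩, hNm, rfl, rfl, ?_, ?_⟩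
  · intro p hp z
    rcases Finset.mem_insert.1 hp with rfl | hp
    · exact hN (Or.inr (Or.inl ⟨z, rfl⟩))
    · exact hNm (hS.pos_mem p hp z)
  · intro p hp z
    rcases Finset.mem_insert.1 hp with rfl | hp
    · exact hN (Or.inr (Or.inr ⟨z, rfl⟩))
    · exact hNm (hS.neg_mem p hp z)
  · intro ν
    obtain ⟨x, hx, hx'⟩ := (hg.exists_iff φ ν.inits.toFinset S.pos
      fun p hp z => Or.inl (hS.pos_mem p hp z)).2 (Filter.Eventually.of_forall fun k => by
        simpa using hEcons k ν)
    simp only [List.mem_toFinset, List.mem_inits] at hx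
    refine ⟨x, hx, fun p hp => ?_⟩
    rcases Finset.mem_insert.1 hp with rfl | hp
    · exact hx _ List.nil_prefix
    · exact hx' p hp
  · intro η ν hν hx
    have := (hg.exists_iff φ {ν, η ++ [true]} ∅ (by simp)).1 (by simpa using hx)
    obtain ⟨k, hk⟩ := this.exists
    exact hEinc k η ν hν (by simpa using hk)
  · intro p hp ν
    rcases Finset.mem_insert.1 hp with rfl | hp
    -- Replace `d ()` by a root `E j []`, then the new node by `E k ν` with `k > j`: these two
    -- conflict.
    · intro hx
      have := (hg'.exists_iff (t := fun k _ => E k []) φ {()} {t ν} (by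
        simp only [Finset.mem_singleton, forall_eq]
        exact fun z => Or.inr ⟨(ν, z), rfl⟩)).1
        (hx.imp fun x hx => ⟨fun _ _ => hx.2, by simpa using hx.1⟩)
      obtain ⟨j, hj⟩ := this.exists
      refine hpair (E j []) ν (fun z => Or.inr ⟨(_, z), rfl⟩) ?_ (by simpa [and_comm] using hj)
      filter_upwards [hU (j + 1)] with k hk
      exact hEE j k ν hk
    · exact hneg p hp ν
  · have h1 := (hg.mono Set.subset_union_left).comp fun z : β => (([] : List Bool), z)
    have h2 := (hg'.mono Set.subset_union_left).comp fun z : β => ((), z)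
    exact h1.sameType h2
  · intro p hp hx
    exact hneg p hp [] (by simpa [and_comm] using hx)

/-- There is no tree witnessing SOP₁ in the monster model. -/
theorem IsIndependence.not_isSOP1Tree {Ind : Set 𝕄 → Set 𝕄 → Set 𝕄 → Prop} [Nonempty 𝕄]
    (hI : IsIndependence L κ Ind) (h𝕄 : IsMonster L 𝕄 κ) [Countable β] (hξ : IsSmall κ ξ)
    (t : List Bool → β → 𝕄) : ¬ IsSOP1Tree φ t := by
  classical
  intro ht
  have hκ := h𝕄.aleph0_lt
  obtain ⟨μ, hμκ, hμ, hL⟩ := h𝕄.exists_card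
  obtain ⟨N₀, -, hN₀⟩ := exists_elementarySubstructure_card_le hμ hL (∅ : Set 𝕄) (by simp)
  let S₀ : {S : TreeStage L 𝕄 β // S.IsGood φ μ} := ⟨⟨N₀, t, ∅, ∅⟩, hN₀, by simp, by simp,
    fun ν => (ht.consistent ν).imp fun x hx => ⟨hx, by simp⟩, ht.inconsistent, by simp⟩
  choose next d hgood hmodel hpos hneg hsame hinc using
    fun S : {S : TreeStage L 𝕄 β // S.IsGood φ μ} => S.2.exists_next h𝕄 hμκ hμ hL
  let S : ℕ → {S : TreeStage L 𝕄 β // S.IsGood φ μ} :=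
    fun n => (fun S => ⟨next S, hgood S⟩)^[n] S₀
  have hS : ∀ n, (S (n + 1)).1 = next (S n) := fun n => by
    simp only [S, Function.iterate_succ_apply']
  have hmono : Monotone fun n => ((S n).1.model : Set 𝕄) := monotone_nat_of_le_succ fun n => by
    rw [hS]
    exact hmodel _
  have hposm : ∀ i j, i < j → d (S i) false ∈ (S j).1.pos := by
    intro i j hij
    induction j, hij using Nat.le_induction with
    | base => rw [hS, hpos]; exact Finset.mem_insert_self _ _
    | succ j hij ih => rw [hS, hpos]; exact Finset.mem_insert_of_mem ih
  have hnegm : ∀ i j, i < j → d (S i) true ∈ (S j).1.neg := by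
    intro i j hij
    induction j, hij using Nat.le_induction with
    | base => rw [hS, hneg]; exact Finset.mem_insert_self _ _
    | succ j hij ih => rw [hS, hneg]; exact Finset.mem_insert_of_mem ih
  obtain ⟨M, hM⟩ := exists_elementarySubstructure_iUnion (fun n => (S n).1.model) hmono
  have hSM : ∀ n, ((S n).1.model : Set 𝕄) ⊆ M := fun n => by
    rw [hM]
    exact Set.subset_iUnion (fun n => ((S n).1.model : Set 𝕄)) n
  have hMs : IsSmall κ M := by
    refine .of_lt (lt_of_le_of_lt ?_ hμκ)
    change #(M : Set 𝕄) ≤ μ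
    rw [hM]
    have h1 := Cardinal.mk_iUnion_le_lift fun n => ((S n).1.model : Set 𝕄)
    rw [Cardinal.lift_uzero, Cardinal.mk_nat, Cardinal.lift_aleph0] at h1
    refine h1.trans (Cardinal.mul_le_of_le hμ hμ ?_)
    refine ciSup_le' fun n => ?_
    rw [Cardinal.lift_uzero]
    exact (S n).2.card_le
  have hd₀ : ∀ i z, d (S i) false z ∈ M := fun i z =>
    hSM (i + 1) ((S (i + 1)).2.pos_mem _ (hposm i _ i.lt_succ_self) z)
  have hd₁ : ∀ i z, d (S i) true z ∈ M := fun i z =>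
    hSM (i + 1) ((S (i + 1)).2.neg_mem _ (hnegm i _ i.lt_succ_self) z)
  obtain ⟨a, ha⟩ := h𝕄.exists_realize hξ hMs (Set.range fun i =>
      φ.relabel (Sum.map id fun z => (⟨d (S i) false z, hd₀ i z⟩ : M))) (by
    intro s hs
    rw [← Set.image_univ] at hs
    obtain ⟨s', -, rfl⟩ := Finset.subset_set_image_iff.1 hs
    obtain ⟨n, hn⟩ := s'.exists_nat_subset_range
    obtain ⟨x, -, hx⟩ := (S n).2.consistent []
    refine ⟨x, fun ψ hψ => ?_⟩
    obtain ⟨i, hi, rfl⟩ := Finset.mem_image.1 hψ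
    exact (realize_map_coe φ (hd₀ i) x).2 (hx _ (hposm i n (Finset.mem_range.1 (hn hi)))))
  refine hI.false_of_averages h𝕄 hMs hξ (IsSmall.of_countable hκ _) φ (fun i => d (S i) false)
    (fun i => d (S i) true) hd₀ hd₁ (fun θ => ?_) a
    (fun i => (realize_map_coe φ (hd₀ i) a).1 (ha _ ⟨i, rfl⟩)) fun i j hij => ?_
  -- The finitely many parameters of `θ` lie in the model of some stage `n`; from there on the two
  -- chosen tuples have the same type over them.
  · let c : Fin (rightArity θ) → M := rightVars θ
    have hfin : ∃ n, ∀ z : Fin (rightArity θ), (c z : 𝕄) ∈ (S n).1.model := by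
      have h1 : ∀ z : Fin (rightArity θ), ∃ n, (c z : 𝕄) ∈ (S n).1.model := fun z => by
        have : (c z : 𝕄) ∈ (M : Set 𝕄) := (c z).2
        rw [hM] at this
        exact Set.mem_iUnion.1 this
      choose n hn using h1
      exact ⟨Finset.univ.sup n, fun z => hmono (Finset.le_sup (Finset.mem_univ z)) (hn z)⟩
    obtain ⟨n, hn⟩ := hfin
    refine ⟨n, fun i hi => ?_⟩
    exact (realize_restrictRight θ _ _).symm.trans
      (((hsame (S i)).realize_iff _ fun z => hmono hi (hn z)).trans (realize_restrictRight θ _ _))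
  · exact hinc (S j) _ (hnegm i j hij)

end Trees

/-! ### Compactness for SOP₁ trees, and NSOP₁. -/

section TreeCompactness

variable {L : FirstOrder.Language.{u, v}} {𝕄 : Type w} [L.Structure 𝕄] {κ : Cardinal.{w}}

theorem IsMonster.exists_realize_formulas (h𝕄 : IsMonster L 𝕄 κ) {γ : Type*} (hγ : IsSmall κ γ)
    (p : Set (L.Formula γ))
    (hp : ∀ s : Finset (L.Formula γ), (s : Set (L.Formula γ)) ⊆ p →
      ∃ a : γ → 𝕄, ∀ φ ∈ s, φ.Realize a) :
    ∃ a : γ → 𝕄, ∀ φ ∈ p, φ.Realize a := by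
  classical
  have key : ∀ (φ : L.Formula γ) (a : γ → 𝕄),
      (φ.relabel (Sum.inl : γ → γ ⊕ (∅ : Set 𝕄))).Realize (Sum.elim a (↑)) ↔ φ.Realize a := by
    intro φ a
    rw [Formula.realize_relabel, Sum.elim_comp_inl]
  obtain ⟨a, ha⟩ := h𝕄.exists_realize hγ (A := ∅) (IsSmall.of_countable h𝕄.aleph0_lt _)
    ((fun φ => φ.relabel Sum.inl) '' p) (by
      intro s hs
      obtain ⟨s', hs', rfl⟩ := Finset.subset_set_image_iff.1 hs
      obtain ⟨a, ha⟩ := hp s' hs'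
      refine ⟨a, fun φ hφ => ?_⟩
      obtain ⟨φ', hφ', rfl⟩ := Finset.mem_image.1 hφ
      exact (key _ _).2 (ha φ' hφ'))
  exact ⟨a, fun φ hφ => (key φ a).1 (ha _ ⟨φ, hφ, rfl⟩)⟩

theorem exists_realize_of_elementarilyEquivalent {N N' : Type*} [L.Structure N] [L.Structure N']
    [Nonempty N] [Nonempty N'] (h : N ≅[L] N') {γ : Type*} (s : Finset (L.Formula γ))
    (a : γ → N) (ha : ∀ φ ∈ s, φ.Realize a) : ∃ a : γ → N', ∀ φ ∈ s, φ.Realize a := by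
  let ψ : L.Formula (γ ⊕ Empty) := (Formula.iInf fun φ : s => φ.1).relabel Sum.inl
  have key : ∀ {K : Type _} [L.Structure K] (c : γ → K) (e : Empty → K),
      ψ.Realize (Sum.elim c e) ↔ ∀ φ ∈ s, φ.Realize c := by
    intro K _ c e
    rw [Formula.realize_relabel, Sum.elim_comp_inl, Formula.realize_iInf, Subtype.forall]
  -- A second copy, for the universe of `N'`.
  have key' : ∀ {K : Type _} [L.Structure K] (c : γ → K) (e : Empty → K),
      ψ.Realize (Sum.elim c e) ↔ ∀ φ ∈ s, φ.Realize c := by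
    intro K _ c e
    rw [Formula.realize_relabel, Sum.elim_comp_inl, Formula.realize_iInf, Subtype.forall]
  have h1 := h.realize_sentence (exLeft ψ)
  have h2 : (exLeft ψ).Realize (default : Empty → N) :=
    (realize_exLeft ψ _).2 ⟨a, (key a _).2 ha⟩
  obtain ⟨c, hc⟩ := (realize_exLeft ψ _).1 (h1.1 h2)
  exact ⟨c, (key' c _).1 hc⟩

variable {ξ β : Type*} (φ : L.Formula (ξ ⊕ β))

/-- The restriction of the tree of tuples `t` to the nodes of length at most `n` looks like a
witness to SOP₁ of `φ`. -/
structure IsSOP1TreeUpTo {N : Type*} [L.Structure N] (n : ℕ) (t : List Bool → β → N) : Prop where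
  consistent : ∀ ν : List Bool, ν.length ≤ n →
    ∃ x : ξ → N, ∀ ρ, ρ <+: ν → φ.Realize (Sum.elim x (t ρ))
  inconsistent : ∀ η ν : List Bool, ν.length ≤ n → η ++ [false] <+: ν →
    ¬ ∃ x : ξ → N, φ.Realize (Sum.elim x (t ν)) ∧ φ.Realize (Sum.elim x (t (η ++ [true])))

/-- The formulas saying that a tree witnesses SOP₁ of `φ` up to height `n`. -/
noncomputable def treeFormulas (n : ℕ) : Set (L.Formula (List Bool × β)) :=
  {ψ | ∃ ν : List Bool, ν.length ≤ n ∧ ψ = consOver φ ν.inits.toFinset} ∪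
  {ψ | ∃ η ν : List Bool, ν.length ≤ n ∧ η ++ [false] <+: ν ∧
    ψ = (consOver φ {ν, η ++ [true]}).not}

theorem treeFormulas_mono : Monotone (treeFormulas φ) := by
  rintro m n hmn ψ (⟨ν, hν, h⟩ | ⟨η, ν, hν, h⟩)
  · exact Or.inl ⟨ν, hν.trans hmn, h⟩
  · exact Or.inr ⟨η, ν, hν.trans hmn, h⟩

theorem isSOP1TreeUpTo_iff {N : Type*} [L.Structure N] [Nonempty N] {n : ℕ}
    {t : List Bool → β → N} :
    IsSOP1TreeUpTo φ n t ↔ ∀ ψ ∈ treeFormulas φ n, ψ.Realize fun z => t z.1 z.2 := by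
  constructor
  · rintro ⟨h1, h2⟩ ψ (⟨ν, hν, rfl⟩ | ⟨η, ν, hν, hη, rfl⟩)
    · rw [realize_consOver]
      simpa using h1 ν hν
    · rw [Formula.realize_not, realize_consOver]
      simpa using h2 η ν hν hη
  · intro h
    refine ⟨fun ν hν => ?_, fun η ν hν hη => ?_⟩
    · have := h _ (Or.inl ⟨ν, hν, rfl⟩)
      rw [realize_consOver] at this
      simpa using this
    · have := h _ (Or.inr ⟨η, ν, hν, hη, rfl⟩)
      rw [Formula.realize_not, realize_consOver] at this
      simpa using this

variable {φ}

/-- A finite set of the formulas describing the tree mentions only bounded height. Its solvability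
passes from `N` to `𝕄`, and saturation applies to the countably many variables. -/
theorem IsMonster.exists_isSOP1Tree (h𝕄 : IsMonster L 𝕄 κ) [Nonempty 𝕄] [Countable β]
    {N : Type*} [L.Structure N] [Nonempty N] (hN : N ≅[L] 𝕄)
    (h : ∀ n, ∃ t : List Bool → β → N, IsSOP1TreeUpTo φ n t) :
    ∃ t : List Bool → β → 𝕄, IsSOP1Tree φ t := by
  obtain ⟨t, ht⟩ := h𝕄.exists_realize_formulas
    (IsSmall.of_countable h𝕄.aleph0_lt (List Bool × β)) (⋃ n, treeFormulas φ n) (by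
      intro s hs
      obtain ⟨n, hn⟩ := (treeFormulas_mono φ).directed_le.exists_mem_subset_of_finset_subset_biUnion
        hs
      obtain ⟨t, ht⟩ := h n
      exact exists_realize_of_elementarilyEquivalent hN s (fun z => t z.1 z.2) fun ψ hψ =>
        (isSOP1TreeUpTo_iff φ).1 ht ψ (hn hψ))
  have key : ∀ n, IsSOP1TreeUpTo φ n fun ν z => t (ν, z) := fun n =>
    (isSOP1TreeUpTo_iff φ).2 fun ψ hψ => ht ψ (Set.mem_iUnion.2 ⟨n, hψ⟩)
  exact ⟨_, fun ν => (key _).consistent ν le_rfl, fun η ν => (key _).inconsistent η ν le_rfl⟩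

theorem IsIndependence.isNSOP1 {Ind : Set 𝕄 → Set 𝕄 → Set 𝕄 → Prop} [Nonempty 𝕄]
    (hI : IsIndependence L κ Ind) (h𝕄 : IsMonster L 𝕄 κ) {T : L.Theory} (hT : T.IsComplete)
    [𝕄 ⊨ T] : IsNSOP1 T := by
  rintro ⟨N, n, m, φ, a, ha, ha'⟩
  have hN : (N : Type _) ≅[L] 𝕄 := elementarilyEquivalent_iff.2 fun ψ =>
    (hT.realize_sentence_iff ψ N).trans (hT.realize_sentence_iff ψ 𝕄).symm
  have hup : ∀ k, IsSOP1TreeUpTo φ k a := by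
    refine fun k => ⟨fun ν _ => ?_, fun η ν _ hη => ha' η ν hη⟩
    -- The branch continues `ν` by zeros; only its nodes up to `ν` are used.
    obtain ⟨x, hx⟩ := ha (fun i => ν.getD i false) (Finset.range (ν.length + 1))
    refine ⟨x, fun ρ hρ => ?_⟩
    have h1 := hx ρ.length (Finset.mem_range.2 (Nat.lt_succ_of_le hρ.length_le))
    have h2 : branchNode (fun i => ν.getD i false) ρ.length = ρ := by
      refine List.ext_getElem (by simp [branchNode]) fun i h2 h3 => ?_
      have h4 : i < ν.length := h3.trans_le hρ.length_le
      simp [branchNode, List.getElem?_eq_getElem h4, hρ.getElem h3]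
    rwa [h2] at h1
  obtain ⟨t, ht⟩ := h𝕄.exists_isSOP1Tree hN (φ := φ) fun k => ⟨a, hup k⟩
  exact hI.not_isSOP1Tree h𝕄 (IsSmall.of_countable h𝕄.aleph0_lt _) t ht

end TreeCompactness

/-! ### SOP₁ trees generated by automorphisms. -/

section ConjugationTree

variable {L : FirstOrder.Language.{u, v}} {𝕄 : Type w} [L.Structure 𝕄]

/-- The composition of those automorphisms `σ i`, `σ (i + 1)`, ... which are selected by a node. -/
def nodeEquiv (σ : ℕ → 𝕄 ≃[L] 𝕄) : ℕ → List Bool → 𝕄 ≃[L] 𝕄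
  | _, [] => Language.Equiv.refl L 𝕄
  | i, false :: η => nodeEquiv σ (i + 1) η
  | i, true :: η => (σ i).comp (nodeEquiv σ (i + 1) η)

theorem nodeEquiv_append (σ : ℕ → 𝕄 ≃[L] 𝕄) (η μ : List Bool) (i : ℕ) (y : 𝕄) :
    nodeEquiv σ i (η ++ μ) y = nodeEquiv σ i η (nodeEquiv σ (i + η.length) μ y) := by
  induction η generalizing i with
  | nil => rfl
  | cons b η ih =>
    have h : i + 1 + η.length = i + (b :: η).length := by simp; omega
    cases b
    · exact (ih (i + 1)).trans (by rw [h]; rfl)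
    · exact (congrArg (σ i) (ih (i + 1))).trans (by rw [h]; rfl)

theorem nodeEquiv_apply_eq_self (σ : ℕ → 𝕄 ≃[L] 𝕄) (μ : List Bool) (i : ℕ) (y : 𝕄)
    (h : ∀ j, i ≤ j → j < i + μ.length → σ j y = y) : nodeEquiv σ i μ y = y := by
  induction μ generalizing i with
  | nil => rfl
  | cons b μ ih =>
    have h' := ih (i + 1) fun j h1 h2 => h j (by omega) (by simp; omega)
    cases b
    · exact h'
    · exact (congrArg (σ i) h').trans (h i le_rfl (by simp))

theorem nodeEquiv_induction (σ : ℕ → 𝕄 ≃[L] 𝕄) {ξ : Type*} (Θ : (ξ → 𝕄) → Prop) (μ : List Bool)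
    (i : ℕ) (h : ∀ j, i ≤ j → j < i + μ.length → ∀ a, Θ (σ j ∘ a) → Θ a) (a : ξ → 𝕄)
    (ha : Θ (nodeEquiv σ i μ ∘ a)) : Θ a := by
  induction μ generalizing i with
  | nil => exact ha
  | cons b μ ih =>
    refine ih (i + 1) (fun j h1 h2 => h j (by omega) (by simp; omega)) ?_
    cases b
    · exact ha
    · exact h i le_rfl (by simp) _ ha

theorem realize_comp_equiv (σ : 𝕄 ≃[L] 𝕄) {ξ β : Type*} (φ : L.Formula (ξ ⊕ β)) (a : ξ → 𝕄)
    (b : β → 𝕄) : φ.Realize (Sum.elim (σ ∘ a) (σ ∘ b)) ↔ φ.Realize (Sum.elim a b) := by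
  rw [← Sum.comp_elim]
  exact StrongHomClass.realize_formula σ φ

/-- A sequence of tuples `e` and automorphisms `σ`, such that `σ i` fixes the tuples before `e i`
and moves `e i` to a tuple which makes `φ` inconsistent with each of the later tuples, generates a
tree witnessing SOP₁. -/
theorem isSOP1TreeUpTo_of_equiv {ξ β : Type*} (φ : L.Formula (ξ ⊕ β)) (H : ℕ) (e : ℕ → β → 𝕄)
    (σ : ℕ → 𝕄 ≃[L] 𝕄) (hfix : ∀ i j, i < j → j ≤ H → ∀ z, σ j (e i z) = e i z)
    (hcons : ∃ a : ξ → 𝕄, ∀ i ≤ H, φ.Realize (Sum.elim a (e i)))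
    (Θ : ℕ → (ξ → 𝕄) → Prop)
    (hΘ : ∀ i ≤ H, ∀ a, φ.Realize (Sum.elim a (σ i ∘ e i)) → Θ i a)
    (hΘfix : ∀ i j, i < j → j ≤ H → ∀ a, Θ i (σ j ∘ a) → Θ i a)
    (hinc : ∀ i j, i ≤ j → j ≤ H → ∀ a, Θ i a → ¬ φ.Realize (Sum.elim a (e j))) :
    IsSOP1TreeUpTo φ H fun η => nodeEquiv σ 1 η ∘ e η.length := by
  constructor
  · intro ν hν
    obtain ⟨a, ha⟩ := hcons
    refine ⟨nodeEquiv σ 1 ν ∘ a, ?_⟩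
    rintro ρ ⟨μ, rfl⟩
    rw [List.length_append] at hν
    -- The automorphisms selected after `ρ` fix `e ρ.length`, so the whole path to `ρ ++ μ` is the
    -- image of an initial segment of `e` under one automorphism.
    have h1 : (nodeEquiv σ 1 ρ ∘ e ρ.length : β → 𝕄) = nodeEquiv σ 1 (ρ ++ μ) ∘ e ρ.length := by
      funext z
      simp only [Function.comp_apply]
      rw [nodeEquiv_append, nodeEquiv_apply_eq_self σ μ]
      exact fun j h1 h2 => hfix _ _ (by omega) (by omega) z
    rw [h1, realize_comp_equiv]
    exact ha _ (by omega)
  · rintro η ν hν ⟨μ, rfl⟩ ⟨x, hx, hx'⟩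
    simp only [List.length_append, List.length_singleton] at hν hx hx'
    obtain ⟨z, rfl⟩ : ∃ z, x = nodeEquiv σ 1 η ∘ z :=
      ⟨(nodeEquiv σ 1 η).symm ∘ x, by funext i; simp⟩
    -- Numbering starts at `1`, so the entry after `η` selects the automorphism with the same index
    -- as the tuple at that node.
    have h1 : (nodeEquiv σ 1 (η ++ [true]) ∘ e (η.length + 1) : β → 𝕄) =
        nodeEquiv σ 1 η ∘ (σ (η.length + 1) ∘ e (η.length + 1)) := by
      funext y
      simp only [Function.comp_apply]
      rw [nodeEquiv_append, add_comm 1]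
      rfl
    have h2 : (nodeEquiv σ 1 (η ++ [false] ++ μ) ∘ e (η.length + 1 + μ.length) : β → 𝕄) =
        nodeEquiv σ 1 η ∘ (nodeEquiv σ (η.length + 2) μ ∘ e (η.length + 1 + μ.length)) := by
      funext y
      simp only [Function.comp_apply]
      rw [List.append_assoc, nodeEquiv_append, add_comm 1]
      rfl
    rw [h1, realize_comp_equiv] at hx'
    rw [h2, realize_comp_equiv] at hx
    -- Pulling `z` back through the automorphisms of `μ` preserves `Θ` and turns the tuple at `ν`
    -- into an original `e j`.
    obtain ⟨z, rfl⟩ : ∃ z', z = nodeEquiv σ (η.length + 2) μ ∘ z' :=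
      ⟨(nodeEquiv σ (η.length + 2) μ).symm ∘ z, by funext i; simp⟩
    rw [realize_comp_equiv] at hx
    refine hinc (η.length + 1) _ (by omega) (by omega) z ?_ hx
    exact nodeEquiv_induction σ (Θ (η.length + 1)) μ (η.length + 2)
      (fun j h1 h2 => hΘfix _ _ (by omega) (by omega)) z (hΘ _ (by omega) _ hx')

end ConjugationTree

/-! ### Morley sequences in several invariant types. -/

section MorleySequences

variable {L : FirstOrder.Language.{u, v}} {𝕄 : Type w} [L.Structure 𝕄] {κ : Cardinal.{w}}

/-- The sequence in which each tuple is obtained by applying `f` to the set of its predecessors. -/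
noncomputable def sequenceOver {ι : Type*} (f : ℕ → Set 𝕄 → ι → 𝕄) (A : Set 𝕄) : ℕ → ι → 𝕄
  | i => f i (A ∪ ⋃ j : Fin i, Set.range (sequenceOver f A j))
decreasing_by exact j.2

theorem exists_sequenceOver (hκ : ℵ₀ < κ) [Nonempty 𝕄] {ι : Type*} (hι : IsSmall κ ι)
    {R : ℕ → Set 𝕄 → (ι → 𝕄) → Prop} (hR : ∀ i (A : Set 𝕄), IsSmall κ A → ∃ a, R i A a) {A : Set 𝕄}
    (hA : IsSmall κ A) :
    ∃ x : ℕ → ι → 𝕄, ∀ i, R i (A ∪ ⋃ j < i, Set.range (x j)) (x i) := by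
  classical
  -- The default value is never taken, since the predecessors always form a small set.
  let f : ℕ → Set 𝕄 → ι → 𝕄 := fun i B =>
    if h : ∃ a, R i B a then h.choose else fun _ => Classical.arbitrary 𝕄
  refine ⟨sequenceOver f A, fun i => ?_⟩
  have hB := hR i _ (hA.union hκ
    (IsSmall.biUnion_lt hκ (fun j => Set.range (sequenceOver f A j)) i fun j _ => hι.range _))
  have h1 : sequenceOver f A i = f i (A ∪ ⋃ j < i, Set.range (sequenceOver f A j)) := by
    conv_lhs => rw [sequenceOver]
    congr 2
    ext y
    simp [Fin.exists_iff]
  rw [h1]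
  simp only [f, dif_pos hB]
  exact hB.choose_spec

/-- A Morley sequence over `A`, the members of which realize possibly different global types. -/
def IsMixedMorleySequence {ι : Type*} (s : ℕ → GlobalType L 𝕄 ι) (A : Set 𝕄) (x : ℕ → ι → 𝕄) :
    Prop :=
  ∀ i : ℕ, (s i).RealizedOver (A ∪ ⋃ j < i, Set.range (x j)) (x i)

variable {ι : Type*} {s : ℕ → GlobalType L 𝕄 ι} {A : Set 𝕄} {x y : ℕ → ι → 𝕄}

theorem IsMixedMorleySequence.comp (hx : IsMixedMorleySequence s A x) {h : ℕ → ℕ}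
    (hh : StrictMono h) : IsMixedMorleySequence (s ∘ h) A (x ∘ h) := fun i =>
  (hx (h i)).mono <| Set.union_subset_union_right _ <| Set.iUnion₂_subset fun j hj =>
    Set.subset_biUnion_of_mem (u := fun j => Set.range (x j)) (show h j < h i from hh hj)

/-- Mixed Morley sequences in invariant types continue conjugate tuples to conjugate tuples. -/
theorem SameType.sum_mixedMorleySequence (hs : ∀ i, (s i).IsInvariant A) {δ : Type*}
    {a a' : δ → 𝕄} (h : SameType L A a a')
    (hx : IsMixedMorleySequence s (A ∪ Set.range a) x)
    (hy : IsMixedMorleySequence s (A ∪ Set.range a') y) (n : ℕ) :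
    SameType L A (Sum.elim a fun z : Fin n × ι => x z.1 z.2)
      (Sum.elim a' fun z : Fin n × ι => y z.1 z.2) := by
  induction n with
  | zero =>
    have key : ∀ (c : δ → 𝕄) (x : ℕ → ι → 𝕄), (Sum.elim c fun z : Fin 0 × ι => x z.1 z.2) =
        c ∘ Sum.elim id fun z => z.1.elim0 := by
      intro c x
      funext z
      rcases z with z | z
      · rfl
      · exact z.1.elim0
    rw [key, key]
    exact h.comp _
  | succ n ih =>
    have hsub : ∀ (c : δ → 𝕄) (x : ℕ → ι → 𝕄),
        A ∪ Set.range (Sum.elim c fun z : Fin n × ι => x z.1 z.2) ⊆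
          A ∪ Set.range c ∪ ⋃ j < n, Set.range (x j) := by
      rintro c x _ (hz | ⟨z | z, rfl⟩)
      · exact Or.inl (Or.inl hz)
      · exact Or.inl (Or.inr ⟨z, rfl⟩)
      · exact Or.inr (Set.mem_biUnion (show (z.1 : ℕ) < n from z.1.2) ⟨z.2, rfl⟩)
    have h1 := ih.sum_realizedOver (hs n) (hx n) (hy n) (hsub a x) (hsub a' y)
    let f : δ ⊕ Fin (n + 1) × ι → (δ ⊕ Fin n × ι) ⊕ ι :=
      Sum.elim (fun z => Sum.inl (Sum.inl z)) fun z =>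
        if h : (z.1 : ℕ) < n then Sum.inl (Sum.inr (⟨z.1, h⟩, z.2)) else Sum.inr z.2
    have key : ∀ (c : δ → 𝕄) (x : ℕ → ι → 𝕄),
        (Sum.elim (Sum.elim c fun z : Fin n × ι => x z.1 z.2) (x n)) ∘ f =
          Sum.elim c fun z : Fin (n + 1) × ι => x z.1 z.2 := by
      intro c x
      funext z
      rcases z with z | ⟨i, z⟩
      · rfl
      · by_cases hi : (i : ℕ) < n
        · simp [f, hi]
        · have : (i : ℕ) = n := by omega
          simp [f, this]
    have h2 := h1.comp f
    rwa [key, key] at h2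

theorem IsMixedMorleySequence.sameType (hs : ∀ i, (s i).IsInvariant A)
    (hx : IsMixedMorleySequence s A x) (hy : IsMixedMorleySequence s A y) (n : ℕ) :
    SameType L A (fun z : Fin n × ι => x z.1 z.2) fun z : Fin n × ι => y z.1 z.2 := by
  have h0 : A ∪ Set.range (Empty.elim : Empty → 𝕄) = A := by
    rw [Set.range_eq_empty, Set.union_empty]
  exact ((SameType.refl A (Empty.elim : Empty → 𝕄)).sum_mixedMorleySequence hs
    (by rwa [h0]) (by rwa [h0]) n).comp Sum.inr

/-- The sequence of types determines the type over `A` of each initial segment, and joint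
consistency is part of that type. -/
theorem IsMixedMorleySequence.exists_iff [Nonempty 𝕄] (hs : ∀ i, (s i).IsInvariant A)
    (hx : IsMixedMorleySequence s A x) (hy : IsMixedMorleySequence s A y) {ξ : Type*}
    (ψ : L.Formula (ξ ⊕ ι)) (n : ℕ) :
    (∃ a : ξ → 𝕄, ∀ i < n, ψ.Realize (Sum.elim a (x i))) ↔
      ∃ a : ξ → 𝕄, ∀ i < n, ψ.Realize (Sum.elim a (y i)) := by
  have key : ∀ x : ℕ → ι → 𝕄, (∃ a : ξ → 𝕄, ∀ i < n, ψ.Realize (Sum.elim a (x i))) ↔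
      ((consOver ψ (Finset.univ : Finset (Fin n))).relabel Sum.inl).Realize
        (Sum.elim (fun z : Fin n × ι => x z.1 z.2) ((↑) : A → 𝕄)) := by
    intro x
    rw [Formula.realize_relabel, Sum.elim_comp_inl,
      realize_consOver ψ _ fun i : Fin n => x i]
    simp [Fin.forall_iff]
  rw [key, key]
  exact hx.sameType hs hy n _

/-- Realizations of the same type continued by a Morley sequence are conjugate over the latter. -/
theorem IsMixedMorleySequence.exists_equiv (h𝕄 : IsMonster L 𝕄 κ) (hA : IsSmall κ A)
    [Countable ι] (hs : ∀ i, (s i).IsInvariant A) (hx : IsMixedMorleySequence s A x) {i j k : ℕ} (hi : i < k)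
    (hj : j < k) (hij : SameType L A (x i) (x j)) (n : ℕ) :
    ∃ σ : 𝕄 ≃[L] 𝕄, (∀ z, σ (x i z) = x j z) ∧ ∀ l, k ≤ l → l < n → ∀ z, σ (x l z) = x l z := by
  -- From `k` on, the sequence is Morley over `A` together with any single earlier member.
  have hsub : ∀ i < k, IsMixedMorleySequence (fun l => s (k + l)) (A ∪ Set.range (x i))
      fun l => x (k + l) := by
    intro i hi l
    refine (hx (k + l)).mono ?_
    rintro z ((hz | hz) | hz)
    · exact Or.inl hz
    · exact Or.inr (Set.mem_biUnion (show i < k + l by omega) hz)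
    · obtain ⟨l', hl', hz⟩ := Set.mem_iUnion₂.1 hz
      exact Or.inr (Set.mem_biUnion (show k + l' < k + l by omega) hz)
  have h := hij.sum_mixedMorleySequence (fun l => hs (k + l)) (hsub i hi) (hsub j hj) (n - k)
  obtain ⟨σ, -, hσ⟩ := h𝕄.exists_equiv (IsSmall.of_countable h𝕄.aleph0_lt _) hA h
  refine ⟨σ, fun z => hσ (Sum.inl z), fun l hl hl' z => ?_⟩
  have := hσ (Sum.inr (⟨l - k, by omega⟩, z))
  simpa [Nat.add_sub_cancel' hl] using this

end MorleySequences

/-! ### Kim's lemma. -/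

section KimLemma

variable {L : FirstOrder.Language.{u, v}} {𝕄 : Type w} [L.Structure 𝕄] {κ : Cardinal.{w}}

/-- For a mixed Morley sequence `x` in types `q` (at the odd places) and `r` (at the even places),
the consistency of `ψ` along subsequences only depends on the pattern of `q` and `r`. -/
theorem IsMixedMorleySequence.exists_iff_of_pattern [Nonempty 𝕄] {ι : Type*} {A : Set 𝕄}
    {q r : GlobalType L 𝕄 ι} (hq : q.IsInvariant A) (hr : r.IsInvariant A) {x : ℕ → ι → 𝕄}
    (hx : IsMixedMorleySequence (fun l => if l % 2 = 1 then q else r) A x) {ξ : Type*}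
    (ψ : L.Formula (ξ ⊕ ι)) {h h' : ℕ → ℕ} (hh : StrictMono h) (hh' : StrictMono h')
    (hhh' : ∀ l, h l % 2 = h' l % 2) (n : ℕ) :
    (∃ a : ξ → 𝕄, ∀ l < n, ψ.Realize (Sum.elim a (x (h l)))) ↔
      ∃ a : ξ → 𝕄, ∀ l < n, ψ.Realize (Sum.elim a (x (h' l))) := by
  have h1 := hx.comp hh
  have h2 := hx.comp hh'
  rw [show ((fun l => if l % 2 = 1 then q else r) ∘ h) =
    (fun l => if l % 2 = 1 then q else r) ∘ h' from funext fun l => by simp [hhh' l] ] at h1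
  refine h1.exists_iff (fun i => ?_) h2 ψ n
  simp only [Function.comp_apply]
  split_ifs
  · exact hq
  · exact hr

variable {Ind : Set 𝕄 → Set 𝕄 → Set 𝕄 → Prop} {M : L.ElementarySubstructure 𝕄}

/-- Kim's lemma: the consistency of `ψ` along Morley sequences in an invariant type only depends on
the restriction of the type to the model. -/
theorem IsIndependence.instancesConsistent_of_morley [Nonempty 𝕄] (hI : IsIndependence L κ Ind)
    (h𝕄 : IsMonster L 𝕄 κ) (hM : IsSmall κ M) {ξ : Type*} (hξ : IsSmall κ ξ) {m : ℕ}
    {q r : GlobalType L 𝕄 (Fin m)} (hq : q.IsInvariant M) (hr : r.IsInvariant M) {b : Fin m → 𝕄}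
    (hqb : q.RealizedOver M b) (hrb : r.RealizedOver M b) (ψ : L.Formula (ξ ⊕ Fin m))
    {w y : ℕ → Fin m → 𝕄} (hw : IsMorleySequence q M w) (hwc : InstancesConsistent ψ w)
    (hy : IsMorleySequence r M y) : InstancesConsistent ψ y := by
  classical
  have hκ := h𝕄.aleph0_lt
  by_contra hyc
  let s : ℕ → GlobalType L 𝕄 (Fin m) := fun l => if l % 2 = 1 then q else r
  have hs : ∀ l, (s l).IsInvariant M := fun l => by
    simp only [s]
    split_ifs
    · exact hq
    · exact hr
  have hsb : ∀ l, (s l).RealizedOver M b := fun l => by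
    simp only [s]
    split_ifs
    · exact hqb
    · exact hrb
  have hm : IsSmall κ (Fin m) := .of_countable hκ _
  obtain ⟨x, hx⟩ : ∃ x, IsMixedMorleySequence s M x :=
    exists_sequenceOver hκ hm (fun i A hA => h𝕄.exists_realizedOver hm (s i) hA) hM
  -- `N` members in `q` (odd places), followed by `n` members in `r` (even places).
  let Cons : ℕ → ℕ → Prop := fun N n =>
    ∃ a : ξ → 𝕄, ∀ l < N + n, ψ.Realize (Sum.elim a (x (2 * l + if l < N then 1 else 0)))
  have hmono : ∀ N, StrictMono fun l => 2 * l + if l < N then 1 else 0 := fun N =>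
    strictMono_nat_of_lt_succ fun l => by
      split_ifs <;> omega
  have h0 : ∀ N, Cons N 0 := by
    intro N
    obtain ⟨a, ha⟩ := hwc (Finset.range N)
    have h1 := hx.comp (h := fun l => 2 * l + 1) fun i j hij => by
      simp only
      omega
    have h2 : s ∘ (fun l => 2 * l + 1) = fun _ => q := funext fun l => by
      have : (2 * l + 1) % 2 = 1 := by omega
      simp [s, this]
    rw [h2] at h1
    obtain ⟨a', ha'⟩ := (IsMixedMorleySequence.exists_iff (fun _ => hq) hw h1 ψ N).1
      ⟨a, fun i hi => ha i (Finset.mem_range.2 hi)⟩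
    refine ⟨a', fun l hl => ?_⟩
    rw [if_pos (by omega)]
    exact ha' l (by omega)
  have hk : ∃ k, ¬ Cons 0 k := by
    by_contra! hcon
    refine hyc fun t => ?_
    obtain ⟨k, hk⟩ := t.exists_nat_subset_range
    obtain ⟨a, ha⟩ := hcon k
    have h1 := hx.comp (h := fun l => 2 * l) fun i j hij => by
      simp only
      omega
    have h2 : s ∘ (fun l => 2 * l) = fun _ => r := funext fun l => by
      simp [s]
    rw [h2] at h1
    obtain ⟨a', ha'⟩ := (IsMixedMorleySequence.exists_iff (fun _ => hr) h1 hy ψ k).1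
      ⟨a, fun i hi => by simpa using ha i (by omega)⟩
    exact ⟨a', fun i hi => ha' i (Finset.mem_range.1 (hk hi))⟩
  -- `n` is the largest number of `r`-members that are consistent after arbitrarily many
  -- `q`-members.
  obtain ⟨n, N₀, hn, hN₀⟩ : ∃ n N₀, (∀ N, Cons N n) ∧ ¬ Cons N₀ (n + 1) := by
    by_contra! hcon
    obtain ⟨k, hk⟩ := hk
    have : ∀ k N, Cons N k := fun k => by
      induction k with
      | zero => exact h0
      | succ k ih => exact fun N => hcon k N ih
    exact hk (this k 0)
  let K := Fin (N₀ + 1) ⊕ Fin n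
  let χ : L.Formula (ξ ⊕ (K × Fin m)) := conjOver ψ Finset.univ
  have hup : ∀ H, ∃ t : List Bool → K × Fin m → 𝕄, IsSOP1TreeUpTo χ H t := by
    intro H
    have hle : ∀ i j, i < j → j ≤ H →
        (H - j) * (N₀ + 1) + (N₀ + 1) ≤ (H - i) * (N₀ + 1) := by
      intro i j hij hj
      rw [← Nat.succ_mul]
      exact Nat.mul_le_mul_right _ (by omega)
    have hle' : ∀ i, (H - i) * (N₀ + 1) + (N₀ + 1) ≤ (H + 1) * (N₀ + 1) := by
      intro i
      rw [← Nat.succ_mul]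
      exact Nat.mul_le_mul_right _ (by omega)
    set B : ℕ := (H + 1) * (N₀ + 1) with hB
    -- Each tuple consists of a block of `N₀ + 1` `q`-members and a tail of `n` `r`-members common
    -- to all tuples. Blocks are laid out backwards, larger `i` first, so an automorphism fixing all
    -- that follows block `j` fixes the tuples of index below `j`.
    let p : ℕ → ℕ := fun i => (H - i) * (N₀ + 1)
    let pos : ℕ → K → ℕ := fun i =>
      Sum.elim (fun k => 2 * (p i + k) + 1) fun c => 2 * (B + c)
    -- `σ i` moves the last `q`-member of block `i` to its neighbour in `r`, which has the same type
    -- over `M`.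
    have hσ : ∀ i, ∃ σ : 𝕄 ≃[L] 𝕄,
        (∀ z, σ (x (2 * (p i + N₀) + 1) z) = x (2 * (p i + N₀)) z) ∧
        ∀ l, 2 * (p i + N₀) + 2 ≤ l → l < 2 * (B + n) → ∀ z, σ (x l z) = x l z := fun i =>
      hx.exists_equiv h𝕄 hM hs (by omega) (by omega)
        (((hx _).mono Set.subset_union_left).sameType ((hx _).mono Set.subset_union_left)
          (hsb _) (hsb _)) _
    choose σ hσ hσfix using hσ
    refine ⟨_, isSOP1TreeUpTo_of_equiv χ H (fun i z => x (pos i z.1) z.2) σ ?_ ?_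
      (fun i a => ψ.Realize (Sum.elim a (x (2 * (p i + N₀))))) ?_ ?_ ?_⟩
    · rintro i j hij hj ⟨k | c, z⟩
      · have h1 := hle i j hij hj
        have h2 := hle' i
        have h3 := k.2
        exact hσfix j _ (by simp only [pos, p, Sum.elim_inl]; omega)
          (by simp only [pos, p, Sum.elim_inl]; omega) z
      · have h1 := hle' j
        have h3 := c.2
        exact hσfix j _ (by simp only [pos, p, Sum.elim_inr]; omega)
          (by simp only [pos, p, Sum.elim_inr]; omega) z
    -- All blocks lie among the first `B` members in `q`, and the tail consists of the `n` members
    -- in `r` after them.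
    · obtain ⟨a, ha⟩ := hn B
      refine ⟨a, fun i hi => (realize_conjOver ψ _ a fun k => x (pos i k)).2 ?_⟩
      rintro (k | c) -
      · have h2 := hle' i
        have h3 := k.2
        have := ha (p i + k) (by simp only [p]; omega)
        rwa [if_pos (by simp only [p]; omega)] at this
      · have h3 := c.2
        have := ha (B + c) (by omega)
        rwa [if_neg (by omega)] at this
    · intro i hi a ha
      have h1 := (realize_conjOver ψ _ a fun k z => σ i (x (pos i k) z)).1 ha
        (Sum.inl (Fin.last N₀)) (Finset.mem_univ _)
      have h2 : (fun z => σ i (x (pos i (Sum.inl (Fin.last N₀))) z)) = x (2 * (p i + N₀)) :=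
        funext fun z => hσ i z
      rwa [h2] at h1
    · intro i j hij hj a ha
      have h1 := hle i j hij hj
      have h2 := hle' i
      rw [← realize_comp_equiv (σ j)]
      rwa [show σ j ∘ x (2 * (p i + N₀)) = x (2 * (p i + N₀)) from funext fun z =>
        hσfix j _ (by simp only [p]; omega) (by simp only [p]; omega) z]
    · intro i j hij hj a ha ha'
      have h1 := (realize_conjOver ψ _ a fun k => x (pos j k)).1 ha'
      have h2 := hle' i
      have h3 : p j ≤ p i := Nat.mul_le_mul_right _ (by omega)
      -- The first `N₀` members of block `j`, then the `r`-member moved to by `σ i`, then the tail: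
      -- `N₀` members in `q` followed by `n + 1` in `r`, the inconsistent pattern.
      let h : ℕ → ℕ := fun l =>
        if l < N₀ then 2 * (p j + l) + 1 else
          if l = N₀ then 2 * (p i + N₀) else 2 * (B + (l - (N₀ + 1)))
      have hh : StrictMono h := strictMono_nat_of_lt_succ fun l => by
        simp only [h]
        simp only [p] at h3 ⊢
        split_ifs <;> omega
      refine hN₀ ((hx.exists_iff_of_pattern hq hr ψ hh (hmono N₀) (fun l => ?_) _).1
        ⟨a, fun l hl => ?_⟩)
      · simp only [h]
        split_ifs <;> omega
      · simp only [h]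
        split_ifs with h4 h5
        · exact h1 (Sum.inl ⟨l, by omega⟩) (Finset.mem_univ _)
        · exact ha
        · exact h1 (Sum.inr ⟨l - (N₀ + 1), by omega⟩) (Finset.mem_univ _)
  obtain ⟨t, ht⟩ := h𝕄.exists_isSOP1Tree (elementarilyEquivalent_iff.2 fun _ => Iff.rfl) hup
  exact hI.not_isSOP1Tree h𝕄 hξ t ht

end KimLemma

/-! ### Comparison with Kim-independence. -/

section KimIndependence

variable {L : FirstOrder.Language.{u, v}} {𝕄 : Type w} [L.Structure 𝕄] {κ : Cardinal.{w}}
  {Ind : Set 𝕄 → Set 𝕄 → Set 𝕄 → Prop} {M : L.ElementarySubstructure 𝕄}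

/-- Independence is preserved, together with a formula `θ(x; p)`, when the right side is replaced
by a coheir sequence of conjugates. -/
theorem IsIndependence.exists_realize_conjugates [Nonempty 𝕄] (hI : IsIndependence L κ Ind)
    (h𝕄 : IsMonster L 𝕄 κ) (hM : IsSmall κ M) {ξ ι : Type*} (hξ : IsSmall κ ξ)
    (hι : IsSmall κ ι) {a : ξ → 𝕄} {b : ι → 𝕄} (hab : Ind (Set.range a) M (Set.range b))
    {I : Type*} {U : Ultrafilter I} {t : I → ι → 𝕄} (ht : ∀ i z, t i z ∈ M)
    {x : ℕ → ι → 𝕄}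
    (hx : ∀ i, RealizesAverage L U t (M ∪ ⋃ j < i, Set.range (x j)) (x i))
    (σ : ℕ → 𝕄 ≃[L] 𝕄) (hσM : ∀ i, ∀ z ∈ (M : Set 𝕄), σ i z = z)
    (hσ : ∀ i z, σ i (b z) = x i z) {δ : Type*} (θ : L.Formula (ξ ⊕ δ)) {p : δ → 𝕄}
    (hp : ∀ z, p z ∈ (M : Set 𝕄) ∪ Set.range b) (hθ : θ.Realize (Sum.elim a p)) :
    ∃ a' : ξ → 𝕄, ∀ i, θ.Realize (Sum.elim a' (σ i ∘ p)) := by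
  classical
  have hκ := h𝕄.aleph0_lt
  let B : ℕ → Set 𝕄 := fun n => ⋃ j < n, Set.range (x j)
  have hB : ∀ n, IsSmall κ (B n) := fun n => IsSmall.biUnion_lt hκ _ n fun j _ => hι.range _
  have hfin : ∀ n, ∃ a' : ξ → 𝕄, SameType L (M : Set 𝕄) a' a ∧ Ind (Set.range a') M (B n) ∧
      ∀ i < n, θ.Realize (Sum.elim a' (σ i ∘ p)) := by
    intro n
    induction n with
    | zero =>
      refine ⟨a, SameType.refl _ _, ?_, by simp⟩
      exact hI.mono hM hab (hξ.range _) (hι.range _) subset_rfl (by simp [B])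
    | succ n ih =>
      obtain ⟨a', h1, h2, h3⟩ := ih
      have hσb : σ n ∘ b = x n := funext (hσ n)
      have h4 : Ind (Set.range (σ n ∘ a)) M (Set.range (x n)) := by
        have := hI.image hM hab (hξ.range a) (hι.range b) (σ n) (hσM n)
        rwa [← Set.range_comp, ← Set.range_comp, hσb] at this
      have h5 : Ind (B n) M (Set.range (x n)) :=
        hI.symm hM (hI.of_realizesAverage hM ht (hB n) hι (hx n)) (hι.range _) (hB n)
      obtain ⟨a'', h6, h7, h8⟩ := hI.amalgam hM hξ (hB n) (hι.range _) h2 h4 h5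
        (h1.trans (sameType_of_equiv (σ n) (hσM n) a))
      have hmem : ∀ i z, σ i (p z) ∈ (M : Set 𝕄) ∪ Set.range (x i) := by
        intro i z
        rcases hp z with hz | ⟨y, hy⟩
        · rw [hσM i _ hz]
          exact Or.inl hz
        · rw [← hy, hσ]
          exact Or.inr ⟨y, rfl⟩
      refine ⟨a'', (h6.mono Set.subset_union_left).trans h1, ?_, fun i hi => ?_⟩
      · rwa [show B (n + 1) = B n ∪ Set.range (x n) from Set.biUnion_lt_succ _ _]
      · rcases Nat.lt_succ_iff_lt_or_eq.1 hi with hi | rfl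
        · refine (h6.realize_iff θ fun z => ?_).2 (h3 i hi)
          rcases hmem i z with hz | hz
          · exact Or.inl hz
          · exact Or.inr (Set.mem_biUnion hi hz)
        · exact (h7.realize_iff θ (hmem i)).2 ((realize_comp_equiv (σ i) θ a p).2 hθ)
  -- `δ` need not be small; keeping only the variables that occur makes the parameter set countable.
  let c : ℕ → Fin (rightArity θ) → 𝕄 := fun i => σ i ∘ p ∘ rightVars θ
  let A : Set 𝕄 := Set.range fun z : ℕ × Fin (rightArity θ) => c z.1 z.2
  have hc : ∀ i z, c i z ∈ A := fun i z => ⟨(i, z), rfl⟩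
  obtain ⟨a', ha'⟩ := h𝕄.exists_realize hξ (A := A) ((IsSmall.of_countable hκ _).range _)
    (Set.range fun i => (restrictRight θ).relabel (Sum.map id fun z => (⟨c i z, hc i z⟩ : A))) (by
      intro s hs
      rw [← Set.image_univ] at hs
      obtain ⟨s', -, rfl⟩ := Finset.subset_set_image_iff.1 hs
      obtain ⟨n, hn⟩ := s'.exists_nat_subset_range
      obtain ⟨a', -, -, ha'⟩ := hfin n
      refine ⟨a', fun ψ hψ => ?_⟩
      obtain ⟨i, hi, rfl⟩ := Finset.mem_image.1 hψ
      exact (realize_map_coe _ (hc i) a').2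
        ((realize_restrictRight θ a' (σ i ∘ p)).2 (ha' i (Finset.mem_range.1 (hn hi)))))
  exact ⟨a', fun i => (realize_restrictRight θ a' (σ i ∘ p)).1
    ((realize_map_coe _ (hc i) a').1 (ha' _ ⟨i, rfl⟩))⟩

/-- Some disjunct stays consistent along a coheir sequence; by Kim's lemma it is then consistent
along the Morley sequence that was to witness its dividing. -/
theorem IsIndependence.kimIndep [Nonempty 𝕄] (hI : IsIndependence L κ Ind)
    (h𝕄 : IsMonster L 𝕄 κ) (hM : IsSmall κ M) {ξ ι : Type*} (hξ : IsSmall κ ξ)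
    (hι : IsSmall κ ι) {a : ξ → 𝕄} {b : ι → 𝕄} (hab : Ind (Set.range a) M (Set.range b)) :
    KimIndep L (M : Set 𝕄) a b := by
  rintro ⟨m, φ, c, ⟨θ, hθa, hθφ⟩, k, l, ψ, d, hφψ, hdiv⟩
  classical
  have hκ := h𝕄.aleph0_lt
  -- The parameters of the disjuncts travel with `b`, so each conjugating automorphism transports
  -- the implication as well. Independence is only needed for the part `b`.
  let γ := ι ⊕ Σ j : Fin k, Fin (l j)
  have hγ : IsSmall κ γ := hι.sum hκ (.of_countable hκ _)
  let e : γ → 𝕄 := Sum.elim b fun z => d z.1 z.2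
  obtain ⟨W, hW⟩ := exists_ultrafilter_coheir M e
  obtain ⟨x, hx⟩ : ∃ x : ℕ → γ → 𝕄, ∀ i, RealizesAverage L W (fun t z => (t z : 𝕄))
      (M ∪ ⋃ j < i, Set.range (x j)) (x i) :=
    exists_sequenceOver (R := fun _ A g => RealizesAverage L W (fun t z => (t z : 𝕄)) A g) hκ hγ
      (fun i A hA => h𝕄.exists_realizesAverage hγ hA W _) hM
  have hσ : ∀ i, ∃ σ : 𝕄 ≃[L] 𝕄, (∀ z ∈ (M : Set 𝕄), σ z = z) ∧ ∀ z, σ (e z) = x i z := fun i =>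
    h𝕄.exists_equiv hγ hM (hW.sameType ((hx i).mono Set.subset_union_left))
  choose σ hσM hσ using hσ
  obtain ⟨a', ha'⟩ := hI.exists_realize_conjugates h𝕄 hM hξ hι hab
    (t := fun (t : γ → M) z => (t (Sum.inl z) : 𝕄)) (fun t z => (t (Sum.inl z)).2)
    (x := fun i => x i ∘ Sum.inl)
    (fun i => ((hx i).comp Sum.inl).mono (Set.union_subset_union_right _
      (Set.iUnion₂_mono fun j _ => Set.range_comp_subset_range _ _)))
    σ hσM (fun i z => hσ i (Sum.inl z)) θ (fun z => z.2) hθa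
  have hj : ∀ i, ∃ j, (ψ j).Realize (Sum.elim a' fun z => x i (Sum.inr ⟨j, z⟩)) := by
    intro i
    obtain ⟨a'', rfl⟩ : ∃ a'', a' = σ i ∘ a'' := ⟨(σ i).symm ∘ a', by funext z; simp⟩
    obtain ⟨j, hj⟩ := hφψ a'' (hθφ a'' ((realize_comp_equiv (σ i) θ a'' _).1 (ha' i)))
    refine ⟨j, ?_⟩
    rw [show (fun z => x i (Sum.inr ⟨j, z⟩)) = σ i ∘ d j from
      funext fun z => (hσ i (Sum.inr ⟨j, z⟩)).symm, realize_comp_equiv]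
    exact hj
  choose j hj using hj
  obtain ⟨j₀, hj₀⟩ := Finite.exists_infinite_fiber j
  let h : ℕ ↪o ℕ := Nat.orderEmbeddingOfSet (j ⁻¹' {j₀})
  have hh : ∀ n, j (h n) = j₀ := fun n => by
    have h1 : h n ∈ Set.range h := ⟨n, rfl⟩
    simp only [h, Nat.orderEmbeddingOfSet_range] at h1
    exact h1
  let f : Fin (l j₀) → γ := fun z => Sum.inr ⟨j₀, z⟩
  obtain ⟨q, hq, hq'⟩ := exists_globalType_average (L := L) W fun t z => (t (f z) : 𝕄)
  obtain ⟨r, hr, hr', y, hy, hyc⟩ := hdiv j₀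
  refine hyc (hI.instancesConsistent_of_morley h𝕄 hM hξ (hq M fun t z => (t (f z)).2) hr
    ((hq' _ _).2 (hW.comp f)) hr' (ψ j₀) (w := fun n => x (h n) ∘ f) (fun n => ?_) (fun s => ?_) hy)
  · refine (hq' _ _).2 (((hx (h n)).comp f).mono (Set.union_subset_union_right _ ?_))
    exact Set.iUnion₂_subset fun i hi => (Set.range_comp_subset_range _ _).trans
      (Set.subset_biUnion_of_mem (u := fun j => Set.range (x j))
        (show h i < h n from h.strictMono hi))
  · refine ⟨a', fun n _ => ?_⟩
    have h1 := hj (h n)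
    rw [hh n] at h1
    exact h1

/-- Witnessing applied to a coheir sequence shows that the formula from strong finite character
Kim-divides, so a disjunction with one member suffices. -/
theorem IsIndependence.of_kimIndep [Nonempty 𝕄] (hI : IsIndependence L κ Ind)
    (h𝕄 : IsMonster L 𝕄 κ) (hwit : Witnessing L κ Ind) (hM : IsSmall κ M) {ξ ι : Type w}
    (hξ : IsSmall κ ξ) (hι : IsSmall κ ι) {a : ξ → 𝕄} {b : ι → 𝕄}
    (hab : KimIndep L (M : Set 𝕄) a b) : Ind (Set.range a) M (Set.range b) := by
  by_contra hn
  have hκ := h𝕄.aleph0_lt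
  obtain ⟨φ, hφ, hφ'⟩ := hI.strongFiniteCharacter M hM.lt ξ ι hξ.lt hι.lt a b hn
  -- The parameters in `M` join the tuple `b`, as witnessing allows no others; by monotonicity
  -- dependence on `b` gives dependence on `e`.
  let e : ι ⊕ M → 𝕄 := Sum.elim b (↑)
  have he : IsSmall κ (ι ⊕ M) := hι.sum hκ hM
  have hmem : ∀ z, e z ∈ (M : Set 𝕄) ∪ Set.range b := by
    rintro (z | z)
    · exact Or.inr ⟨z, rfl⟩
    · exact Or.inl z.2
  have hdep : ∀ a' : ξ → 𝕄, ¬ Ind (Set.range a') M (Set.range b) →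
      ¬ Ind (Set.range a') M (Set.range e) := fun a' h h' =>
    h (hI.mono hM h' (hξ.range _) (he.range _) subset_rfl (by
      rintro _ ⟨z, rfl⟩
      exact ⟨Sum.inl z, rfl⟩))
  obtain ⟨W, hW⟩ := exists_ultrafilter_coheir M e
  obtain ⟨x, hx⟩ : ∃ x : ℕ → ι ⊕ M → 𝕄, ∀ i, RealizesAverage L W (fun t z => (t z : 𝕄))
      (M ∪ ⋃ j < i, Set.range (x j)) (x i) :=
    exists_sequenceOver (R := fun _ A g => RealizesAverage L W (fun t z => (t z : 𝕄)) A g) hκ he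
      (fun i A hA => h𝕄.exists_realizesAverage he hA W _) hM
  obtain ⟨q, hq, hq'⟩ := exists_globalType_average (L := L) W fun t z => (t z : 𝕄)
  have hinc : ¬ InstancesConsistent φ x :=
    hwit M hM.lt ξ (ι ⊕ M) hξ.lt he.lt a e φ (hdep a hn) hφ (fun a' ha' => hdep a' (hφ' a' ha'))
      q (hq M fun t z => (t z).2) ((hq' _ _).2 hW) x fun i => (hq' _ _).2 (hx i)
  let f := rightVars φ
  obtain ⟨r, hr, hr'⟩ := exists_globalType_average (L := L) W fun t z => (t (f z) : 𝕄)
  refine hab ⟨_, restrictRight φ, e ∘ f, ⟨φ.relabel (Sum.map id fun z => ⟨e z, hmem z⟩),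
    (realize_map_coe φ hmem a).2 hφ, fun a' ha' => (realize_restrictRight φ a' e).2
      ((realize_map_coe φ hmem a').1 ha')⟩, 1, fun _ => _, fun _ => restrictRight φ,
    fun _ => e ∘ f, fun a' ha' => ⟨0, ha'⟩, fun _ => ⟨r, hr M fun t z => (t (f z)).2,
    (hr' _ _).2 (hW.comp f), fun i => x i ∘ f, fun i => (hr' _ _).2 ?_, fun hc => hinc ?_⟩⟩
  · exact ((hx i).comp f).mono (Set.union_subset_union_right _
      (Set.iUnion₂_mono fun j _ => Set.range_comp_subset_range _ _))
  · exact fun s => (hc s).imp fun a' ha' i hi => (realize_restrictRight φ a' (x i)).1 (ha' i hi)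

end KimIndependence

end KimCriterion

theorem theorem9p1 {L : FirstOrder.Language.{u, v}} {T : L.Theory} (hT : T.IsComplete)
    {𝕄 : Type w} [L.Structure 𝕄] [Nonempty 𝕄] [𝕄 ⊨ T] {κ : Cardinal.{w}}
    (h𝕄 : KimCriterion.IsMonster L 𝕄 κ)
    (Ind : Set 𝕄 → Set 𝕄 → Set 𝕄 → Prop)
    (hinv : KimCriterion.Invariance L κ Ind)
    (hsfc : KimCriterion.StrongFiniteCharacter L κ Ind)
    (hex : KimCriterion.ExistenceOverModels L κ Ind)
    (hmon : KimCriterion.Monotonicity L κ Ind)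
    (hsym : KimCriterion.Symmetry L κ Ind)
    (hind : KimCriterion.IndependenceTheorem L κ Ind) :
    KimCriterion.IsNSOP1 T ∧
    (∀ M : L.ElementarySubstructure 𝕄, #M < κ →
      ∀ (ξ ι : Type w), #ξ < κ → #ι < κ → ∀ (a : ξ → 𝕄) (b : ι → 𝕄),
        Ind (Set.range a) M (Set.range b) → KimCriterion.KimIndep L (M : Set 𝕄) a b) ∧
    (KimCriterion.Witnessing L κ Ind →
      ∀ M : L.ElementarySubstructure 𝕄, #M < κ →
      ∀ (ξ ι : Type w), #ξ < κ → #ι < κ → ∀ (a : ξ → 𝕄) (b : ι → 𝕄),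
        Ind (Set.range a) M (Set.range b) ↔ KimCriterion.KimIndep L (M : Set 𝕄) a b) := by
  have hI : KimCriterion.IsIndependence L κ Ind := ⟨hinv, hsfc, hex, hmon, hsym, hind⟩
  have hkim : ∀ M : L.ElementarySubstructure 𝕄, #M < κ →
      ∀ (ξ ι : Type w), #ξ < κ → #ι < κ → ∀ (a : ξ → 𝕄) (b : ι → 𝕄),
        Ind (Set.range a) M (Set.range b) → KimCriterion.KimIndep L (M : Set 𝕄) a b :=
    fun M hM ξ ι hξ hι a b => hI.kimIndep h𝕄 (.of_lt hM) (.of_lt hξ) (.of_lt hι)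
  exact ⟨hI.isNSOP1 h𝕄 hT, hkim, fun hwit M hM ξ ι hξ hι a b =>
    ⟨hkim M hM ξ ι hξ hι a b, hI.of_kimIndep h𝕄 hwit (.of_lt hM) (.of_lt hξ) (.of_lt hι)⟩⟩
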